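/- Let $H$ be an infinite-dimensional separable complex Hilbert space (so $H\cong\ell^2$). Let $S_1(H)$ be the Banach space of trace class operators on $H$ with norm $\|T\|_1=\operatorname{Tr}|T|$, and let $K=S_2(H)$ be the Hilbert space of Hilbert–Schmidt operators, which is a Banach algebra under composition. Give the dual space $K^*$ the Banach algebra structure $\langle\,\cdot\,,T\rangle\,\langle\,\cdot\,,S\rangle:=\langle\,\cdot\,,TS\rangle$ for $T,S\in K$. For Banach spaces $E,F$ let $E\otimes^\gamma F$ be the projective tensor product; if $E,F$ are Banach algebras, it is a Banach algebra with $(a\otimes b)(a'\otimes b')=aa'\otimes bb'$. For a Banach algebra $A$, $\omega\in A^*$, $a,b\in A$ and $f,g\in A^{**}$, put $\omega_a(b)=\omega(ab)$, ${}_a\omega(b)=\omega(ba)$, $\omega_f(a)=f({}_a\omega)$, ${}_f\omega(a)=f(\omega_a)$; the two Arens products on $A^{**}$ are $(f\,\Box\, g)(\omega)=f({}_g\omega)$ and $(f\diamond g)(\omega)=g(\omega_f)$. The algebra $A$ is Arens regular if $\Box=\diamond$. Its left (right) topological centre is the set of all $\varphi\in A^{**}$ with $\varphi\,\Box\,\psi=\varphi\diamond\psi$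 (respectively $\psi\,\Box\,\varphi=\psi\diamond\varphi$) for all $\psi\in A^{**}$. It is strongly Arens irregular if both topological centres equal the canonical image of $A$ in $A^{**}$. Then the following hold. 1. $S_1(H)$ is the predual of $B(H)$: the map $B\mapsto\big(T\mapsto\operatorname{Tr}(BT)\big)$ is an isometric isomorphism of $B(H)$ onto $S_1(H)^*$. 2. $H$ and $K$ are isometrically isomorphic Hilbert spaces. 3. $K^*\otimes^\gamma K$ and $K\otimes^\gamma K$ are isometrically isomorphic Banach algebras. 4. There is an isometric isomorphism $\Phi:S_1(H)\to H^*\otimes^\gamma H$ that sends the operator $z\mapsto\varphi(z)\,y$ to $\varphi\otimes y$ for all $\varphi\in H^*$, $y\in H$. 5. For every unitary $V:H\to K$ there is an isometric isomorphism $\Psi_V:H^*\otimes^\gamma H\to K^*\otimes^\gamma K$ with $\Psi_V(\varphi\otimes y)=(\varphi\circ V^{-1})\otimes Vy$ for all $\varphi\in H^*$, $y\in H$. With the Banach algebra structure that $S_1(H)$ inherits from $K^*\otimes^\gamma K$ through $\Psi_V\circ\Phi$, the predual $S_1(H)$ of $B(H)$ is neither Arens regular nor strongly Arens irregular. -/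

import Mathlib

open scoped InnerProductSpace ENNReal TensorProduct

noncomputable section

namespace Predual

section Schatten

variable {H : Type*} [NormedAddCommGroup H] [InnerProductSpace ℂ H] [CompleteSpace H]

variable (H) in
/-- Index set of a chosen orthonormal basis of the Hilbert space `H`. -/
def BasisIndex : Set H := (exists_hilbertBasis ℂ H).choose

variable (H) in
/-- A chosen orthonormal basis of the Hilbert space `H`. -/
def stdBasis : HilbertBasis (BasisIndex H) ℂ H := (exists_hilbertBasis ℂ H).choose_spec.choose

/-- The canonical trace of a positive operator, with values in `[0, ∞]`, computed in a chosen
orthonormal basis; by `opTrace_eq` every orthonormal basis gives the same value. -/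
def opTrace (T : H →L[ℂ] H) : ℝ≥0∞ :=
  ∑' i, ENNReal.ofReal (RCLike.re ⟪stdBasis H i, T (stdBasis H i)⟫_ℂ)

/-- The Schatten `p`-norm `(Tr |T| ^ p) ^ (1 / p)`, with value `∞` off the Schatten class. -/
def schattenENorm (p : ℝ) (T : H →L[ℂ] H) : ℝ≥0∞ :=
  opTrace (CFC.abs T ^ p) ^ (1 / p)

/-- The sum `∑ i, ‖T eᵢ‖ ^ 2`. -/
def hsSum {ι : Type*} (e : HilbertBasis ι ℂ H) (T : H →L[ℂ] H) : ℝ≥0∞ :=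
  ∑' i, ‖T (e i)‖ₑ ^ 2

theorem tsum_enorm_inner_sq {ι : Type*} (e : HilbertBasis ι ℂ H) (x : H) :
    ∑' i, ‖⟪e i, x⟫_ℂ‖ₑ ^ 2 = ‖x‖ₑ ^ 2 := by
  have h := e.hasSum_inner_mul_inner x x
  have h2 : HasSum (fun i => ‖⟪e i, x⟫_ℂ‖ ^ 2) (‖x‖ ^ 2) := by
    have := Complex.hasSum_re h
    convert this using 1
    · ext i
      rw [← inner_conj_symm x (e i), RCLike.conj_mul]
      norm_cast
    · rw [inner_self_eq_norm_sq_to_K]; norm_cast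
  have h3 : ∀ y : ℂ, ‖y‖ₑ ^ 2 = ENNReal.ofReal (‖y‖ ^ 2) := fun y => by
    rw [ENNReal.ofReal_pow (norm_nonneg _), ofReal_norm]
  simp_rw [h3]
  rw [← ENNReal.ofReal_tsum_of_nonneg (fun i => sq_nonneg _) h2.summable, h2.tsum_eq,
    ENNReal.ofReal_pow (norm_nonneg _), ofReal_norm]

theorem hsSum_adjoint {ι κ : Type*} (e : HilbertBasis ι ℂ H) (f : HilbertBasis κ ℂ H)
    (T : H →L[ℂ] H) : hsSum e T = hsSum f (star T) := by
  unfold hsSum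
  simp_rw [← tsum_enorm_inner_sq f (T (e _)), ← tsum_enorm_inner_sq e (star T (f _))]
  rw [ENNReal.tsum_comm]
  refine tsum_congr fun j => tsum_congr fun i => ?_
  rw [ContinuousLinearMap.star_eq_adjoint, ContinuousLinearMap.adjoint_inner_right,
    ← inner_conj_symm, ← ofReal_norm, RCLike.norm_conj, ofReal_norm]

theorem hsSum_eq {ι κ : Type*} (e : HilbertBasis ι ℂ H) (f : HilbertBasis κ ℂ H)
    (T : H →L[ℂ] H) : hsSum e T = hsSum f T := by
  rw [hsSum_adjoint e f, hsSum_adjoint f f, star_star]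

theorem tsum_inner_star_mul_self {ι : Type*} (e : HilbertBasis ι ℂ H) (T : H →L[ℂ] H) :
    ∑' i, ENNReal.ofReal (RCLike.re ⟪e i, (star T * T) (e i)⟫_ℂ) = hsSum e T := by
  refine tsum_congr fun i => ?_
  rw [ContinuousLinearMap.star_eq_adjoint, mul_apply_eq_comp,
    ContinuousLinearMap.adjoint_inner_right, inner_self_eq_norm_sq,
    ENNReal.ofReal_pow (norm_nonneg _), ofReal_norm]

theorem star_sqrt_mul_sqrt {P : H →L[ℂ] H} (hP : 0 ≤ P) :
    star (CFC.sqrt P) * CFC.sqrt P = P := by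
  rw [(IsSelfAdjoint.of_nonneg (CFC.sqrt_nonneg P)).star_eq, CFC.sqrt_mul_sqrt_self P hP]

/-- The trace of a positive operator does not depend on the orthonormal basis. -/
theorem opTrace_eq {ι : Type*} (e : HilbertBasis ι ℂ H) {P : H →L[ℂ] H} (hP : 0 ≤ P) :
    opTrace P = ∑' i, ENNReal.ofReal (RCLike.re ⟪e i, P (e i)⟫_ℂ) := by
  have h : ∀ {κ : Type _} (f : HilbertBasis κ ℂ H),
      ∑' i, ENNReal.ofReal (RCLike.re ⟪f i, P (f i)⟫_ℂ) = hsSum f (CFC.sqrt P) := fun f => by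
    rw [← tsum_inner_star_mul_self, star_sqrt_mul_sqrt hP]
  have h' : ∑' i, ENNReal.ofReal (RCLike.re ⟪e i, P (e i)⟫_ℂ) = hsSum e (CFC.sqrt P) := by
    rw [← tsum_inner_star_mul_self, star_sqrt_mul_sqrt hP]
  rw [opTrace, h, h', hsSum_eq]

theorem opTrace_star_mul_self (T : H →L[ℂ] H) : opTrace (star T * T) = hsSum (stdBasis H) T :=
  tsum_inner_star_mul_self _ T

theorem schattenENorm_two_sq (T : H →L[ℂ] H) :
    schattenENorm 2 T ^ 2 = hsSum (stdBasis H) T := by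
  have : CFC.abs T ^ (2 : ℝ) = star T * T := by
    have h := CFC.rpow_natCast (CFC.abs T) 2 (CFC.abs_nonneg T)
    rw [CFC.abs_sq] at h
    exact_mod_cast h
  rw [schattenENorm, this, opTrace_star_mul_self, ← ENNReal.rpow_natCast, ← ENNReal.rpow_mul]
  norm_num

theorem schattenENorm_one (T : H →L[ℂ] H) : schattenENorm 1 T = opTrace (CFC.abs T) := by
  rw [schattenENorm, CFC.rpow_one _ (CFC.abs_nonneg T)]
  simp

theorem schattenENorm_one_eq_hsSum {ι : Type*} (e : HilbertBasis ι ℂ H) (T : H →L[ℂ] H) :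
    schattenENorm 1 T = hsSum e (CFC.sqrt (CFC.abs T)) := by
  rw [schattenENorm_one, opTrace_eq e (CFC.abs_nonneg T), ← tsum_inner_star_mul_self,
    star_sqrt_mul_sqrt (CFC.abs_nonneg T)]

theorem enorm_apply_sq_le {ι : Type*} (e : HilbertBasis ι ℂ H) (T : H →L[ℂ] H) (x : H) :
    ‖T x‖ₑ ^ 2 ≤ hsSum e T * ‖x‖ₑ ^ 2 := by
  rw [hsSum_adjoint e e, hsSum, ← ENNReal.tsum_mul_right, ← tsum_enorm_inner_sq e]
  refine ENNReal.tsum_le_tsum fun i => ?_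
  rw [← mul_pow, ContinuousLinearMap.star_eq_adjoint, ← ContinuousLinearMap.adjoint_inner_left]
  gcongr
  simp only [← ofReal_norm]
  rw [← ENNReal.ofReal_mul (norm_nonneg _)]
  exact ENNReal.ofReal_le_ofReal (norm_inner_le_norm _ _)

theorem hsSum_mul_le_left {ι : Type*} (e : HilbertBasis ι ℂ H) (S T : H →L[ℂ] H) :
    hsSum e (S * T) ≤ ‖S‖ₑ ^ 2 * hsSum e T := by
  unfold hsSum
  rw [← ENNReal.tsum_mul_left]
  refine ENNReal.tsum_le_tsum fun i => ?_
  rw [← mul_pow]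
  gcongr
  exact S.le_opENorm _

theorem hsSum_mul_le_right {ι : Type*} (e : HilbertBasis ι ℂ H) (S T : H →L[ℂ] H) :
    hsSum e (S * T) ≤ hsSum e S * ‖T‖ₑ ^ 2 := by
  rw [hsSum_adjoint e e, star_mul, mul_comm]
  refine (hsSum_mul_le_left e _ _).trans_eq ?_
  rw [hsSum_adjoint e e S]
  congr 2
  rw [← ofReal_norm, norm_star, ofReal_norm]

theorem schattenENorm_two_eq (T : H →L[ℂ] H) :
    schattenENorm 2 T = hsSum (stdBasis H) T ^ (1 / 2 : ℝ) := by
  rw [← schattenENorm_two_sq, ← ENNReal.rpow_natCast, ← ENNReal.rpow_mul]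
  norm_num

theorem schattenENorm_two_ne_top_iff (T : H →L[ℂ] H) :
    schattenENorm 2 T ≠ ∞ ↔ Memℓp (fun i => T (stdBasis H i)) 2 := by
  rw [schattenENorm_two_eq, ne_eq, ENNReal.rpow_eq_top_iff_of_pos (by norm_num), ← ne_eq, hsSum,
    memℓp_gen_iff (by norm_num)]
  have : ∀ i, ‖T (stdBasis H i)‖ₑ ^ 2 = ((‖T (stdBasis H i)‖₊ ^ 2 : NNReal) : ℝ≥0∞) := fun i => by
    push_cast; rfl
  simp_rw [this]
  rw [ENNReal.tsum_coe_ne_top_iff_summable, ← NNReal.summable_coe]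
  simp

variable (H) in
/-- The Hilbert–Schmidt operators, as a subspace of the bounded operators. -/
def hilbertSchmidtSubmodule : Submodule ℂ (H →L[ℂ] H) where
  carrier := {T | schattenENorm 2 T ≠ ∞}
  zero_mem' := by
    rw [Set.mem_ofPred_eq, schattenENorm_two_ne_top_iff]
    exact zero_memℓp
  add_mem' {S T} hS hT := by
    rw [Set.mem_ofPred_eq, schattenENorm_two_ne_top_iff] at *
    exact hS.add hT
  smul_mem' c T hT := by
    rw [Set.mem_ofPred_eq, schattenENorm_two_ne_top_iff] at *
    exact hT.const_smul c

variable (H) in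
/-- The space `S₂(H)` of Hilbert–Schmidt operators, to be normed by the Schatten `2`-norm. -/
def HilbertSchmidt : Type _ := hilbertSchmidtSubmodule H

namespace HilbertSchmidt

instance : AddCommGroup (HilbertSchmidt H) := inferInstanceAs (AddCommGroup (hilbertSchmidtSubmodule H))

instance : Module ℂ (HilbertSchmidt H) := inferInstanceAs (Module ℂ (hilbertSchmidtSubmodule H))

/-- The bounded operator underlying a Hilbert–Schmidt operator. -/
def toOp : HilbertSchmidt H →ₗ[ℂ] (H →L[ℂ] H) := (hilbertSchmidtSubmodule H).subtype

theorem toOp_injective : Function.Injective (toOp (H := H)) := Subtype.val_injective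

@[ext] theorem ext {S T : HilbertSchmidt H} (h : toOp S = toOp T) : S = T := toOp_injective h

theorem schattenENorm_ne_top (T : HilbertSchmidt H) : schattenENorm 2 (toOp T) ≠ ∞ := T.2

/-- A bounded operator with finite Schatten `2`-norm, as an element of `S₂(H)`. -/
def mk (T : H →L[ℂ] H) (hT : schattenENorm 2 T ≠ ∞) : HilbertSchmidt H := ⟨T, hT⟩

@[simp] theorem toOp_mk (T : H →L[ℂ] H) (hT : schattenENorm 2 T ≠ ∞) : toOp (mk T hT) = T := rfl

/-- The columns `T eᵢ` of a Hilbert–Schmidt operator, as a square summable family. -/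
def columns : HilbertSchmidt H →ₗ[ℂ] lp (fun _ : BasisIndex H => H) 2 where
  toFun T := ⟨fun i => toOp T (stdBasis H i),
    (schattenENorm_two_ne_top_iff _).1 T.schattenENorm_ne_top⟩
  map_add' S T := by ext i; rfl
  map_smul' c T := by ext i; rfl

theorem columns_apply (T : HilbertSchmidt H) (i : BasisIndex H) :
    columns T i = toOp T (stdBasis H i) := rfl

theorem columns_injective : Function.Injective (columns (H := H)) := by
  intro S T h
  ext1
  refine ContinuousLinearMap.ext_on
    (Submodule.dense_iff_topologicalClosure_eq_top.2 (stdBasis H).dense_span) ?_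
  rintro _ ⟨i, rfl⟩
  rw [← columns_apply, h, columns_apply]

/-- The Schatten `2`-norm. -/
instance : Norm (HilbertSchmidt H) := ⟨fun T => (schattenENorm 2 (toOp T)).toReal⟩

/-- The inner product `Tr (S* T)`, conjugate linear in `S` as everywhere in Mathlib. -/
instance : Inner ℂ (HilbertSchmidt H) :=
  ⟨fun S T => ∑' i, ⟪stdBasis H i, (star (toOp S) * toOp T) (stdBasis H i)⟫_ℂ⟩

theorem norm_def (T : HilbertSchmidt H) : ‖T‖ = (schattenENorm 2 (toOp T)).toReal := rfl

theorem norm_columns (T : HilbertSchmidt H) : ‖columns T‖ = ‖T‖ := by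
  rw [norm_def, schattenENorm_two_eq, ← ENNReal.toReal_rpow, lp.norm_eq_tsum_rpow (by norm_num),
    hsSum, ENNReal.tsum_toReal_eq (fun i => by finiteness)]
  simp [columns_apply]

theorem inner_columns (S T : HilbertSchmidt H) : ⟪columns S, columns T⟫_ℂ = ⟪S, T⟫_ℂ := by
  rw [lp.inner_eq_tsum]
  refine tsum_congr fun i => ?_
  rw [ContinuousLinearMap.star_eq_adjoint, mul_apply_eq_comp,
    ContinuousLinearMap.adjoint_inner_right, columns_apply, columns_apply]

instance : NormedAddCommGroup (HilbertSchmidt H) :=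
  AddGroupNorm.toNormedAddCommGroup
    { toFun := fun T => ‖T‖
      map_zero' := by rw [← norm_columns, map_zero, norm_zero]
      add_le' := fun S T => by
        simp only [← norm_columns, map_add]
        exact norm_add_le _ _
      neg' := fun T => by simp only [← norm_columns, map_neg, norm_neg]
      eq_zero_of_map_eq_zero' := fun T hT => by
        rw [← norm_columns, norm_eq_zero] at hT
        exact columns_injective (hT.trans (map_zero _).symm) }

instance : InnerProductSpace ℂ (HilbertSchmidt H) where
  norm_smul_le c T := by
    rw [← norm_columns, ← norm_columns T, map_smul, norm_smul]
  norm_sq_eq_re_inner T := by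
    rw [← inner_columns, ← norm_columns, ← norm_sq_eq_re_inner]
  conj_inner_symm S T := by
    rw [← inner_columns, ← inner_columns, inner_conj_symm]
  add_left R S T := by
    simp only [← inner_columns, map_add, inner_add_left]
  smul_left S T c := by
    simp only [← inner_columns, map_smul, inner_smul_left]

/-- The columns of a Hilbert–Schmidt operator depend isometrically on it. -/
def columnsₗᵢ : HilbertSchmidt H →ₗᵢ[ℂ] lp (fun _ : BasisIndex H => H) 2 :=
  ⟨columns, norm_columns⟩

theorem norm_toOp_le (T : HilbertSchmidt H) : ‖toOp T‖ ≤ ‖T‖ := by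
  refine ContinuousLinearMap.opNorm_le_bound _ (norm_nonneg _) fun x => ?_
  have h := enorm_apply_sq_le (stdBasis H) (toOp T) x
  rw [← schattenENorm_two_sq, ← mul_pow, ENNReal.pow_le_pow_left_iff two_ne_zero] at h
  have h2 := ENNReal.toReal_mono (by finiteness [T.schattenENorm_ne_top]) h
  simpa [ENNReal.toReal_mul, ← norm_def] using h2

theorem mul_ne_top (S : H →L[ℂ] H) (T : HilbertSchmidt H) : schattenENorm 2 (S * toOp T) ≠ ∞ := by
  have h := hsSum_mul_le_left (stdBasis H) S (toOp T)
  rw [← schattenENorm_two_sq, ← schattenENorm_two_sq, ← mul_pow,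
    ENNReal.pow_le_pow_left_iff two_ne_zero] at h
  exact ne_top_of_le_ne_top (by finiteness [T.schattenENorm_ne_top]) h

/-- Composition of Hilbert–Schmidt operators. -/
instance : Mul (HilbertSchmidt H) := ⟨fun S T => mk (toOp S * toOp T) (mul_ne_top _ _)⟩

@[simp] theorem toOp_mul (S T : HilbertSchmidt H) : toOp (S * T) = toOp S * toOp T := rfl

theorem norm_mul_le (S T : HilbertSchmidt H) : ‖S * T‖ ≤ ‖S‖ * ‖T‖ := by
  have h := hsSum_mul_le_left (stdBasis H) (toOp S) (toOp T)
  rw [← schattenENorm_two_sq, ← schattenENorm_two_sq, ← mul_pow,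
    ENNReal.pow_le_pow_left_iff two_ne_zero] at h
  have h2 := ENNReal.toReal_mono (by finiteness [T.schattenENorm_ne_top]) h
  rw [ENNReal.toReal_mul] at h2
  refine h2.trans ?_
  rw [toReal_enorm]
  exact mul_le_mul_of_nonneg_right (norm_toOp_le S) (norm_nonneg T)

/-- The inclusion of `S₂(H)` into the bounded operators, as a continuous map. -/
def toOpL : HilbertSchmidt H →L[ℂ] (H →L[ℂ] H) :=
  toOp.mkContinuous 1 fun T => by rw [one_mul]; exact norm_toOp_le T

instance : CompleteSpace (HilbertSchmidt H) := by
  refine Metric.complete_of_cauchySeq_tendsto fun u hu => ?_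
  obtain ⟨T, hT⟩ := cauchySeq_tendsto_of_complete (toOpL.lipschitz.uniformContinuous.comp_cauchySeq hu)
  obtain ⟨g, hg⟩ := cauchySeq_tendsto_of_complete
    ((columnsₗᵢ (H := H)).lipschitz.uniformContinuous.comp_cauchySeq hu)
  have key : ∀ i, T (stdBasis H i) = g i := fun i => by
    refine tendsto_nhds_unique (f := fun n => toOp (u n) (stdBasis H i))
      (l := Filter.atTop) ?_ ?_
    · exact ((ContinuousLinearMap.apply ℂ H (stdBasis H i)).continuous.tendsto T).comp hT
    · exact ((lp.evalCLM ℂ (fun _ : BasisIndex H => H) 2 i).continuous.tendsto g).comp hg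
  have hTm : schattenENorm 2 T ≠ ∞ := by
    rw [schattenENorm_two_ne_top_iff, funext key]
    exact lp.memℓp g
  refine ⟨mk T hTm, ?_⟩
  have hgT : g = columnsₗᵢ (mk T hTm) := by
    ext i
    rw [← key i]
    rfl
  rw [hgT] at hg
  exact (columnsₗᵢ (H := H)).isometry.isEmbedding.tendsto_nhds_iff.2 hg

end HilbertSchmidt

theorem exists_contraction {A B : H →L[ℂ] H} (h : ∀ x, ‖B x‖ ≤ ‖A x‖) :
    ∃ C : H →L[ℂ] H, ‖C‖ ≤ 1 ∧ C * A = B := by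
  let K : Submodule ℂ H := (LinearMap.range A.toLinearMap).topologicalClosure
  have : CompleteSpace K :=
    (LinearMap.range A.toLinearMap).isClosed_topologicalClosure.completeSpace_coe
  let e : H →ₗ[ℂ] K := A.toLinearMap.codRestrict K fun x =>
    Submodule.le_topologicalClosure _ (LinearMap.mem_range_self _ x)
  have hd : DenseRange e := by
    intro y
    rw [closure_subtype]
    refine closure_mono ?_ y.2
    rintro _ ⟨x, rfl⟩
    exact ⟨e x, ⟨x, rfl⟩, rfl⟩
  have hn : ∀ x, ‖B.toLinearMap x‖ ≤ 1 * ‖e x‖ := fun x => by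
    rw [one_mul]; exact h x
  let C₀ : K →L[ℂ] H := B.toLinearMap.extendOfNorm e
  refine ⟨C₀ ∘L K.orthogonalProjectionOnto, ?_, ?_⟩
  · refine ContinuousLinearMap.opNorm_le_bound _ zero_le_one fun x => ?_
    refine (LinearMap.norm_extendOfNorm_apply_le hd 1 hn _).trans ?_
    gcongr
    exact K.norm_orthogonalProjectionOnto_apply_le x
  · ext x
    have : K.orthogonalProjectionOnto (A x) = e x :=
      K.orthogonalProjectionOnto_mem_subspace_eq_self (e x)
    rw [mul_apply_eq_comp, ContinuousLinearMap.comp_apply, this]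
    exact LinearMap.extendOfNorm_eq hd ⟨1, hn⟩ x

theorem norm_abs_apply (T : H →L[ℂ] H) (x : H) : ‖CFC.abs T x‖ = ‖T x‖ := by
  have h : ⟪CFC.abs T x, CFC.abs T x⟫_ℂ = ⟪T x, T x⟫_ℂ := by
    rw [← ContinuousLinearMap.adjoint_inner_right, ← ContinuousLinearMap.adjoint_inner_right,
      ← ContinuousLinearMap.star_eq_adjoint, ← ContinuousLinearMap.star_eq_adjoint,
      (IsSelfAdjoint.of_nonneg (CFC.abs_nonneg T)).star_eq, ← mul_apply_eq_comp,
      ← mul_apply_eq_comp, CFC.abs_mul_abs]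
  rw [← sq_eq_sq₀ (norm_nonneg _) (norm_nonneg _), ← inner_self_eq_norm_sq (𝕜 := ℂ),
    ← inner_self_eq_norm_sq (𝕜 := ℂ), h]

theorem enorm_inner_le (x y : H) : ‖⟪x, y⟫_ℂ‖ₑ ≤ ‖x‖ₑ * ‖y‖ₑ := by
  simp only [← ofReal_norm]
  rw [← ENNReal.ofReal_mul (norm_nonneg _)]
  exact ENNReal.ofReal_le_ofReal (norm_inner_le_norm _ _)

theorem two_mul_enorm_inner_le (x y : H) : 2 * ‖⟪x, y⟫_ℂ‖ₑ ≤ ‖x‖ₑ ^ 2 + ‖y‖ₑ ^ 2 := by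
  refine (mul_le_mul_right (enorm_inner_le x y) 2).trans ?_
  rw [enorm_eq_nnnorm, enorm_eq_nnnorm, ← mul_assoc]
  exact_mod_cast two_mul_le_add_sq ‖x‖₊ ‖y‖₊

theorem tsum_inner_le {ι : Type*} (e : HilbertBasis ι ℂ H) {U : H →L[ℂ] H} (hU : ‖U‖ ≤ 1)
    (T : H →L[ℂ] H) : ∑' i, ‖⟪e i, (U * T) (e i)⟫_ℂ‖ₑ ≤ schattenENorm 1 T := by
  rw [schattenENorm_one_eq_hsSum e]
  obtain ⟨W, hW, hWT⟩ := exists_contraction (A := CFC.abs T) (B := T)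
    fun x => (norm_abs_apply T x).ge
  set R := CFC.sqrt (CFC.abs T) with hR
  have hRR : R * R = CFC.abs T := CFC.sqrt_mul_sqrt_self _ (CFC.abs_nonneg T)
  have hRs : star R = R := (IsSelfAdjoint.of_nonneg (CFC.sqrt_nonneg _)).star_eq
  set D := star (U * W) with hD
  have hDn : ‖D‖ₑ ≤ 1 := by
    rw [← ofReal_norm, hD, norm_star, ← ENNReal.ofReal_one]
    exact ENNReal.ofReal_le_ofReal ((norm_mul_le _ _).trans (mul_le_one₀ hU (norm_nonneg _) hW))
  have h1 : ∀ i, ⟪e i, (U * T) (e i)⟫_ℂ = ⟪(R * D) (e i), R (e i)⟫_ℂ := fun i => by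
    have : U * T = star D * star R * R := by
      rw [hD, star_star, hRs, mul_assoc (U * W), hRR, mul_assoc, hWT]
    rw [this, ← star_mul, mul_apply_eq_comp, ContinuousLinearMap.star_eq_adjoint,
      ContinuousLinearMap.adjoint_inner_right]
  have h2 : 2 * ∑' i, ‖⟪e i, (U * T) (e i)⟫_ℂ‖ₑ ≤ 2 * hsSum e R := by
    rw [← ENNReal.tsum_mul_left]
    calc ∑' i, 2 * ‖⟪e i, (U * T) (e i)⟫_ℂ‖ₑ
        ≤ ∑' i, (‖(R * D) (e i)‖ₑ ^ 2 + ‖R (e i)‖ₑ ^ 2) :=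
          ENNReal.tsum_le_tsum fun i => by rw [h1]; exact two_mul_enorm_inner_le _ _
      _ = hsSum e (R * D) + hsSum e R := ENNReal.tsum_add
      _ ≤ hsSum e R * 1 + hsSum e R := by
          gcongr
          refine (hsSum_mul_le_right e R D).trans ?_
          gcongr
          exact pow_le_one₀ (by simp) hDn
      _ = 2 * hsSum e R := by rw [mul_one, two_mul]
  exact (ENNReal.mul_le_mul_iff_right two_ne_zero ENNReal.ofNat_ne_top).1 h2

theorem exists_schattenENorm_one_eq (T : H →L[ℂ] H) : ∃ U : H →L[ℂ] H, ‖U‖ ≤ 1 ∧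
    schattenENorm 1 T =
      ∑' i, ENNReal.ofReal (RCLike.re ⟪stdBasis H i, (U * T) (stdBasis H i)⟫_ℂ) := by
  obtain ⟨U, hU, hUT⟩ := exists_contraction (A := T) (B := CFC.abs T)
    fun x => (norm_abs_apply T x).le
  exact ⟨U, hU, by rw [schattenENorm_one, hUT]; rfl⟩

theorem ofReal_re_le (z : ℂ) : ENNReal.ofReal (RCLike.re z) ≤ ‖z‖ₑ := by
  rw [← ofReal_norm]
  exact ENNReal.ofReal_le_ofReal (RCLike.re_le_norm z)

theorem schattenENorm_one_add_le (S T : H →L[ℂ] H) :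
    schattenENorm 1 (S + T) ≤ schattenENorm 1 S + schattenENorm 1 T := by
  obtain ⟨U, hU, hUT⟩ := exists_schattenENorm_one_eq (S + T)
  rw [hUT]
  refine le_trans ?_ (add_le_add (tsum_inner_le (stdBasis H) hU S)
    (tsum_inner_le (stdBasis H) hU T))
  rw [← ENNReal.tsum_add]
  refine ENNReal.tsum_le_tsum fun i => (ofReal_re_le _).trans ?_
  rw [mul_add, add_apply, inner_add_right]
  exact enorm_add_le _ _

theorem schattenENorm_one_smul_le (c : ℂ) (T : H →L[ℂ] H) :
    schattenENorm 1 (c • T) ≤ ‖c‖ₑ * schattenENorm 1 T := by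
  obtain ⟨U, hU, hUT⟩ := exists_schattenENorm_one_eq (c • T)
  rw [hUT]
  refine le_trans ?_ (mul_le_mul_right (tsum_inner_le (stdBasis H) hU T) _)
  rw [← ENNReal.tsum_mul_left]
  refine ENNReal.tsum_le_tsum fun i => (ofReal_re_le _).trans ?_
  rw [mul_smul_comm, smul_apply, inner_smul_right, enorm_mul]

theorem schattenENorm_one_neg (T : H →L[ℂ] H) : schattenENorm 1 (-T) = schattenENorm 1 T := by
  rw [schattenENorm, CFC.abs_neg, schattenENorm]

theorem schattenENorm_one_zero : schattenENorm 1 (0 : H →L[ℂ] H) = 0 := by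
  simp [schattenENorm_one, opTrace]

theorem enorm_apply_le_schattenENorm_one (T : H →L[ℂ] H) (x : H) :
    ‖T x‖ₑ ≤ schattenENorm 1 T * ‖x‖ₑ := by
  rw [schattenENorm_one_eq_hsSum (stdBasis H), ← ENNReal.pow_le_pow_left_iff two_ne_zero]
  set R := CFC.sqrt (CFC.abs T) with hR
  have h : ‖T x‖ₑ = ‖R (R x)‖ₑ := by
    rw [← mul_apply_eq_comp, CFC.sqrt_mul_sqrt_self _ (CFC.abs_nonneg T), ← ofReal_norm,
      ← ofReal_norm, norm_abs_apply]
  calc ‖T x‖ₑ ^ 2 ≤ hsSum (stdBasis H) R * ‖R x‖ₑ ^ 2 := by rw [h]; exact enorm_apply_sq_le _ _ _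
    _ ≤ hsSum (stdBasis H) R * (hsSum (stdBasis H) R * ‖x‖ₑ ^ 2) := by
        gcongr; exact enorm_apply_sq_le _ _ _
    _ = (hsSum (stdBasis H) R * ‖x‖ₑ) ^ 2 := by ring

variable (H) in
/-- The trace class operators, as a subspace of the bounded operators. -/
def traceClassSubmodule : Submodule ℂ (H →L[ℂ] H) where
  carrier := {T | schattenENorm 1 T ≠ ∞}
  zero_mem' := by simp [schattenENorm_one_zero]
  add_mem' {S T} hS hT :=
    ne_top_of_le_ne_top (ENNReal.add_ne_top.2 ⟨hS, hT⟩) (schattenENorm_one_add_le S T)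
  smul_mem' c T hT :=
    ne_top_of_le_ne_top (ENNReal.mul_ne_top enorm_ne_top hT) (schattenENorm_one_smul_le c T)

variable (H) in
/-- The space `S₁(H)` of trace class operators, to be normed by the trace norm `Tr |T|`. -/
def TraceClass : Type _ := traceClassSubmodule H

namespace TraceClass

instance : AddCommGroup (TraceClass H) := inferInstanceAs (AddCommGroup (traceClassSubmodule H))

instance : Module ℂ (TraceClass H) := inferInstanceAs (Module ℂ (traceClassSubmodule H))

/-- The bounded operator underlying a trace class operator. -/
def toOp : TraceClass H →ₗ[ℂ] (H →L[ℂ] H) := (traceClassSubmodule H).subtype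

theorem toOp_injective : Function.Injective (toOp (H := H)) := Subtype.val_injective

@[ext] theorem ext {S T : TraceClass H} (h : toOp S = toOp T) : S = T := toOp_injective h

theorem schattenENorm_ne_top (T : TraceClass H) : schattenENorm 1 (toOp T) ≠ ∞ := T.2

/-- A bounded operator with finite trace norm, as an element of `S₁(H)`. -/
def mk (T : H →L[ℂ] H) (hT : schattenENorm 1 T ≠ ∞) : TraceClass H := ⟨T, hT⟩

@[simp] theorem toOp_mk (T : H →L[ℂ] H) (hT : schattenENorm 1 T ≠ ∞) : toOp (mk T hT) = T := rfl

/-- The trace norm. -/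
instance : Norm (TraceClass H) := ⟨fun T => (schattenENorm 1 (toOp T)).toReal⟩

theorem norm_def (T : TraceClass H) : ‖T‖ = (schattenENorm 1 (toOp T)).toReal := rfl

theorem norm_toOp_le (T : TraceClass H) : ‖toOp T‖ ≤ ‖T‖ := by
  refine ContinuousLinearMap.opNorm_le_bound _ ENNReal.toReal_nonneg fun x => ?_
  have h := ENNReal.toReal_mono (by finiteness [T.schattenENorm_ne_top])
    (enorm_apply_le_schattenENorm_one (toOp T) x)
  simpa [ENNReal.toReal_mul, ← norm_def] using h

instance : NormedAddCommGroup (TraceClass H) :=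
  AddGroupNorm.toNormedAddCommGroup
    { toFun := fun T => ‖T‖
      map_zero' := by rw [norm_def, map_zero, schattenENorm_one_zero, ENNReal.toReal_zero]
      add_le' := fun S T => by
        simp only [norm_def, map_add]
        rw [← ENNReal.toReal_add S.schattenENorm_ne_top T.schattenENorm_ne_top]
        exact ENNReal.toReal_mono (ENNReal.add_ne_top.2
          ⟨S.schattenENorm_ne_top, T.schattenENorm_ne_top⟩) (schattenENorm_one_add_le _ _)
      neg' := fun T => by simp only [norm_def, map_neg, schattenENorm_one_neg]
      eq_zero_of_map_eq_zero' := fun T hT => by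
        have h := norm_toOp_le T
        rw [hT] at h
        exact toOp_injective ((norm_le_zero_iff.1 h).trans (map_zero _).symm) }

instance : NormedSpace ℂ (TraceClass H) where
  norm_smul_le c T := by
    rw [norm_def, norm_def, map_smul, ← toReal_enorm c, ← ENNReal.toReal_mul]
    exact ENNReal.toReal_mono (ENNReal.mul_ne_top enorm_ne_top T.schattenENorm_ne_top)
      (schattenENorm_one_smul_le _ _)

/-- The inclusion of `S₁(H)` into the bounded operators, as a continuous map. -/
def toOpL : TraceClass H →L[ℂ] (H →L[ℂ] H) :=
  toOp.mkContinuous 1 fun T => by rw [one_mul]; exact norm_toOp_le T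

theorem schattenENorm_eq_ofReal (T : TraceClass H) :
    schattenENorm 1 (toOp T) = ENNReal.ofReal ‖T‖ :=
  (ENNReal.ofReal_toReal T.schattenENorm_ne_top).symm

instance : CompleteSpace (TraceClass H) := by
  refine Metric.complete_of_cauchySeq_tendsto fun u hu => ?_
  obtain ⟨T, hT⟩ := cauchySeq_tendsto_of_complete (toOpL.lipschitz.uniformContinuous.comp_cauchySeq hu)
  have key : ∀ ε > 0, ∃ N, ∀ n ≥ N, schattenENorm 1 (T - toOp (u n)) ≤ ENNReal.ofReal ε := by
    intro ε hε
    obtain ⟨N, hN⟩ := Metric.cauchySeq_iff.1 hu ε hε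
    refine ⟨N, fun n hn => ?_⟩
    obtain ⟨U, hU, hUT⟩ := exists_schattenENorm_one_eq (T - toOp (u n))
    rw [hUT]
    rw [ENNReal.tsum_eq_iSup_sum]
    refine iSup_le fun s => ?_
    have hlim : Filter.Tendsto (fun m => ∑ i ∈ s, ENNReal.ofReal
        (RCLike.re ⟪stdBasis H i, (U * (toOp (u m) - toOp (u n))) (stdBasis H i)⟫_ℂ))
        Filter.atTop (nhds (∑ i ∈ s, ENNReal.ofReal
        (RCLike.re ⟪stdBasis H i, (U * (T - toOp (u n))) (stdBasis H i)⟫_ℂ))) := by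
      have hc : Continuous fun R : H →L[ℂ] H => ∑ i ∈ s, ENNReal.ofReal
          (RCLike.re ⟪stdBasis H i, (U * (R - toOp (u n))) (stdBasis H i)⟫_ℂ) := by
        exact continuous_finsetSum _ fun i _ => ENNReal.continuous_ofReal.comp (by fun_prop)
      exact (hc.tendsto T).comp hT
    refine le_of_tendsto hlim (Filter.eventually_atTop.2 ⟨N, fun m hm => ?_⟩)
    calc _ ≤ ∑ i ∈ s, ‖⟪stdBasis H i, (U * (toOp (u m) - toOp (u n))) (stdBasis H i)⟫_ℂ‖ₑ :=
          Finset.sum_le_sum fun i _ => ofReal_re_le _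
      _ ≤ _ := ENNReal.sum_le_tsum s
      _ ≤ schattenENorm 1 (toOp (u m) - toOp (u n)) := tsum_inner_le _ hU _
      _ = ENNReal.ofReal ‖u m - u n‖ := by rw [← map_sub, schattenENorm_eq_ofReal]
      _ ≤ ENNReal.ofReal ε := ENNReal.ofReal_le_ofReal (by
          rw [← dist_eq_norm]; exact (hN m hm n hn).le)
  have hTm : schattenENorm 1 T ≠ ∞ := by
    obtain ⟨N, hN⟩ := key 1 one_pos
    have := schattenENorm_one_add_le (T - toOp (u N)) (toOp (u N))
    rw [sub_add_cancel] at this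
    exact ne_top_of_le_ne_top (ENNReal.add_ne_top.2 ⟨ne_top_of_le_ne_top ENNReal.ofReal_ne_top
      (hN N le_rfl), (u N).schattenENorm_ne_top⟩) this
  refine ⟨mk T hTm, Metric.tendsto_atTop.2 fun ε hε => ?_⟩
  obtain ⟨N, hN⟩ := key (ε / 2) (half_pos hε)
  refine ⟨N, fun n hn => ?_⟩
  rw [dist_comm, dist_eq_norm, norm_def, map_sub, toOp_mk]
  exact (ENNReal.toReal_le_of_le_ofReal (half_pos hε).le (hN n hn)).trans_lt (half_lt_self hε)

end TraceClass

end Schatten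

section ProjectiveTensorProduct

variable (E F : Type*) [NormedAddCommGroup E] [NormedSpace ℂ E]
  [NormedAddCommGroup F] [NormedSpace ℂ F]

/-- The algebraic tensor product `E ⊗ F`, to be normed by the projective norm. -/
def AlgTensor : Type _ := E ⊗[ℂ] F

namespace AlgTensor

instance : AddCommGroup (AlgTensor E F) := inferInstanceAs (AddCommGroup (E ⊗[ℂ] F))

instance : Module ℂ (AlgTensor E F) := inferInstanceAs (Module ℂ (E ⊗[ℂ] F))

variable {E F}

/-- The elementary tensor `x ⊗ y`. -/
def tmul (x : E) (y : F) : AlgTensor E F := x ⊗ₜ[ℂ] y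

theorem tmul_add_left (x x' : E) (y : F) : tmul (x + x') y = tmul x y + tmul x' y :=
  TensorProduct.add_tmul x x' y

theorem smul_tmul (c : ℂ) (x : E) (y : F) : c • tmul x y = tmul (c • x) y := rfl

@[elab_as_elim]
theorem induction_on {p : AlgTensor E F → Prop} (u : AlgTensor E F) (zero : p 0)
    (tmul : ∀ x y, p (tmul x y)) (add : ∀ u v, p u → p v → p (u + v)) : p u :=
  TensorProduct.induction_on u zero tmul add

/-- The costs `∑ ‖aᵢ‖ ‖bᵢ‖` of the representations `u = ∑ aᵢ ⊗ bᵢ`. -/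
def costs (u : AlgTensor E F) : Set ℝ :=
  {r | ∃ (n : ℕ) (a : Fin n → E) (b : Fin n → F),
    u = ∑ i, tmul (a i) (b i) ∧ r = ∑ i, ‖a i‖ * ‖b i‖}

/-- The projective norm. -/
instance : Norm (AlgTensor E F) := ⟨fun u => sInf (costs u)⟩

theorem norm_def (u : AlgTensor E F) : ‖u‖ = sInf (costs u) := rfl

theorem zero_mem_costs : (0 : ℝ) ∈ costs (0 : AlgTensor E F) :=
  ⟨0, Fin.elim0, Fin.elim0, by simp, by simp⟩

theorem add_mem_costs {u v : AlgTensor E F} {r s : ℝ} (hr : r ∈ costs u) (hs : s ∈ costs v) :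
    r + s ∈ costs (u + v) := by
  obtain ⟨n, a, b, rfl, rfl⟩ := hr
  obtain ⟨m, a', b', rfl, rfl⟩ := hs
  refine ⟨n + m, Fin.append a a', Fin.append b b', ?_, ?_⟩ <;> simp [Fin.sum_univ_add]

theorem smul_mem_costs (c : ℂ) {u : AlgTensor E F} {r : ℝ} (hr : r ∈ costs u) :
    ‖c‖ * r ∈ costs (c • u) := by
  obtain ⟨n, a, b, rfl, rfl⟩ := hr
  refine ⟨n, fun i => c • a i, b, ?_, ?_⟩
  · simp [Finset.smul_sum, smul_tmul]
  · simp [Finset.mul_sum, norm_smul, mul_assoc]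

theorem tmul_mem_costs (x : E) (y : F) : ‖x‖ * ‖y‖ ∈ costs (tmul x y) :=
  ⟨1, fun _ => x, fun _ => y, by simp, by simp⟩

theorem costs_nonneg {u : AlgTensor E F} {r : ℝ} (hr : r ∈ costs u) : 0 ≤ r := by
  obtain ⟨n, a, b, -, rfl⟩ := hr
  positivity

theorem bddBelow_costs (u : AlgTensor E F) : BddBelow (costs u) := ⟨0, fun _ => costs_nonneg⟩

theorem costs_nonempty (u : AlgTensor E F) : (costs u).Nonempty := by
  induction u using AlgTensor.induction_on with
  | zero => exact ⟨0, zero_mem_costs⟩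
  | tmul x y => exact ⟨_, tmul_mem_costs x y⟩
  | add u v hu hv => exact ⟨_, add_mem_costs hu.some_mem hv.some_mem⟩

theorem norm_le_of_mem {u : AlgTensor E F} {r : ℝ} (hr : r ∈ costs u) : ‖u‖ ≤ r :=
  csInf_le (bddBelow_costs u) hr

theorem exists_cost_lt (u : AlgTensor E F) {ε : ℝ} (hε : 0 < ε) : ∃ r ∈ costs u, r < ‖u‖ + ε :=
  exists_lt_of_csInf_lt (costs_nonempty u) (lt_add_of_pos_right _ hε)

theorem norm_zero' : ‖(0 : AlgTensor E F)‖ = 0 :=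
  le_antisymm (norm_le_of_mem zero_mem_costs)
    (le_csInf (costs_nonempty _) fun _ => costs_nonneg)

theorem norm_add_le' (u v : AlgTensor E F) : ‖u + v‖ ≤ ‖u‖ + ‖v‖ := by
  refine le_of_forall_pos_le_add fun ε hε => ?_
  obtain ⟨r, hr, hr'⟩ := exists_cost_lt u (half_pos hε)
  obtain ⟨s, hs, hs'⟩ := exists_cost_lt v (half_pos hε)
  have := norm_le_of_mem (add_mem_costs hr hs)
  linarith

theorem norm_smul_le' (c : ℂ) (u : AlgTensor E F) : ‖c • u‖ ≤ ‖c‖ * ‖u‖ := by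
  refine le_of_forall_pos_le_add fun ε hε => ?_
  obtain ⟨r, hr, hr'⟩ := exists_cost_lt u (ε := ε / (‖c‖ + 1)) (by positivity)
  refine (norm_le_of_mem (smul_mem_costs c hr)).trans ?_
  have h1 : ‖c‖ * r ≤ ‖c‖ * (‖u‖ + ε / (‖c‖ + 1)) :=
    mul_le_mul_of_nonneg_left hr'.le (norm_nonneg c)
  have h2 : ‖c‖ * (ε / (‖c‖ + 1)) ≤ ε := by
    rw [← mul_div_assoc, div_le_iff₀ (by positivity)]
    nlinarith [norm_nonneg c]
  linarith [mul_add ‖c‖ ‖u‖ (ε / (‖c‖ + 1))]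

/-- The projective norm, as a seminorm. -/
def projectiveSeminorm : Seminorm ℂ (AlgTensor E F) :=
  Seminorm.ofSMulLE (fun u => ‖u‖) norm_zero' norm_add_le' norm_smul_le'

instance : SeminormedAddCommGroup (AlgTensor E F) :=
  AddGroupSeminorm.toSeminormedAddCommGroup
    (projectiveSeminorm (E := E) (F := F)).toAddGroupSeminorm

instance : NormedSpace ℂ (AlgTensor E F) := ⟨norm_smul_le'⟩

theorem norm_tmul_le (x : E) (y : F) : ‖tmul x y‖ ≤ ‖x‖ * ‖y‖ :=
  norm_le_of_mem (tmul_mem_costs x y)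

/-- A linear map bounded by `‖x‖ ‖y‖` on elementary tensors is bounded by the projective norm. -/
theorem bound_of_tmul {G : Type*} [SeminormedAddCommGroup G] [Module ℂ G] {C : ℝ}
    (f : AlgTensor E F →ₗ[ℂ] G)
    (hC : 0 ≤ C) (hf : ∀ x y, ‖f (tmul x y)‖ ≤ C * (‖x‖ * ‖y‖)) (u : AlgTensor E F) :
    ‖f u‖ ≤ C * ‖u‖ := by
  have h1 : ∀ r ∈ costs u, ‖f u‖ ≤ C * r := by
    rintro r ⟨n, a, b, rfl, rfl⟩
    rw [map_sum, Finset.mul_sum]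
    exact (norm_sum_le _ _).trans (Finset.sum_le_sum fun i _ => hf _ _)
  refine le_of_forall_pos_le_add fun ε hε => ?_
  obtain ⟨r, hr, hr'⟩ := exists_cost_lt u (ε := ε / (C + 1)) (by positivity)
  refine (h1 r hr).trans ?_
  have h2 : C * r ≤ C * (‖u‖ + ε / (C + 1)) := mul_le_mul_of_nonneg_left hr'.le hC
  have h3 : C * (ε / (C + 1)) ≤ ε := by
    rw [← mul_div_assoc, div_le_iff₀ (by positivity)]
    nlinarith
  linarith [mul_add C ‖u‖ (ε / (C + 1))]

end AlgTensor

/-- The projective tensor product `E ⊗^γ F` of Banach spaces: the completion of the algebraic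
tensor product in the projective norm. -/
abbrev ProjTensor : Type _ := UniformSpace.Completion (AlgTensor E F)

/-- The canonical map of the algebraic tensor product into `E ⊗^γ F`. -/
def ProjTensor.coeL : AlgTensor E F →L[ℂ] ProjTensor E F := UniformSpace.Completion.toComplL

variable {E F} in
/-- The elementary tensor `x ⊗ y` in `E ⊗^γ F`. -/
def ProjTensor.tmul (x : E) (y : F) : ProjTensor E F := (AlgTensor.tmul x y : AlgTensor E F)

end ProjectiveTensorProduct

section BanachAlgebra

variable {X Y : Type*} [NormedAddCommGroup X] [NormedSpace ℂ X] [CompleteSpace X]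
  [NormedAddCommGroup Y] [NormedSpace ℂ Y] [CompleteSpace Y]

/-- A multiplication that makes the Banach space `X` a (not necessarily unital) Banach algebra.
It is kept as data, apart from `X`, since one Banach space carries several of them. -/
structure BanachAlgebraStructure (X : Type*) [NormedAddCommGroup X] [NormedSpace ℂ X]
    [CompleteSpace X] where
  /-- The multiplication. -/
  mul : X →L[ℂ] X →L[ℂ] X
  mul_assoc : ∀ a b c, mul (mul a b) c = mul a (mul b c)
  norm_mul_le : ∀ a b, ‖mul a b‖ ≤ ‖a‖ * ‖b‖

namespace BanachAlgebraStructure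

/-- The multiplication of `Y` carried over to `X` along a surjective linear isometry. -/
def induced (M : BanachAlgebraStructure Y) (Φ : X ≃ₗᵢ[ℂ] Y) : BanachAlgebraStructure X where
  mul := LinearMap.mkContinuous₂ (LinearMap.mk₂ ℂ (fun a b => Φ.symm (M.mul (Φ a) (Φ b)))
      (by simp) (by simp) (by simp) (by simp)) 1
    (fun a b => by simpa using M.norm_mul_le (Φ a) (Φ b))
  mul_assoc a b c := by simp [M.mul_assoc]
  norm_mul_le a b := by simpa using M.norm_mul_le (Φ a) (Φ b)

theorem induced_mul (M : BanachAlgebraStructure Y) (Φ : X ≃ₗᵢ[ℂ] Y) (a b : X) :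
    (M.induced Φ).mul a b = Φ.symm (M.mul (Φ a) (Φ b)) := rfl

section Arens

variable (M : BanachAlgebraStructure X)

/-- `ω_a = (L_a)* ω`, that is, `ω_a b = ω (a b)`. -/
def dualRight (ω : StrongDual ℂ X) (a : X) : StrongDual ℂ X := ω ∘L M.mul a

/-- `ₐω = (R_a)* ω`, that is, `ₐω b = ω (b a)`. -/
def dualLeft (ω : StrongDual ℂ X) (a : X) : StrongDual ℂ X := ω ∘L M.mul.flip a

/-- The functional `_f ω : a ↦ f (ω_a)`, which depends linearly and continuously on `ω`. -/
def bidualLeft (f : StrongDual ℂ (StrongDual ℂ X)) : StrongDual ℂ X →L[ℂ] StrongDual ℂ X :=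
  ContinuousLinearMap.compL ℂ X (StrongDual ℂ X) ℂ f ∘L
    (ContinuousLinearMap.compL ℂ X (X →L[ℂ] X) (StrongDual ℂ X)).flip M.mul ∘L
      ContinuousLinearMap.compL ℂ X X ℂ

theorem bidualLeft_apply (f : StrongDual ℂ (StrongDual ℂ X)) (ω : StrongDual ℂ X) (a : X) :
    M.bidualLeft f ω a = f (M.dualRight ω a) := rfl

/-- The functional `ω_f : a ↦ f (ₐω)`, which depends linearly and continuously on `ω`. -/
def bidualRight (f : StrongDual ℂ (StrongDual ℂ X)) : StrongDual ℂ X →L[ℂ] StrongDual ℂ X :=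
  ContinuousLinearMap.compL ℂ X (StrongDual ℂ X) ℂ f ∘L
    (ContinuousLinearMap.compL ℂ X (X →L[ℂ] X) (StrongDual ℂ X)).flip M.mul.flip ∘L
      ContinuousLinearMap.compL ℂ X X ℂ

theorem bidualRight_apply (f : StrongDual ℂ (StrongDual ℂ X)) (ω : StrongDual ℂ X) (a : X) :
    M.bidualRight f ω a = f (M.dualLeft ω a) := rfl

/-- The first Arens product `(f □ g) ω = f (_g ω)`. -/
def arensBox (f g : StrongDual ℂ (StrongDual ℂ X)) : StrongDual ℂ (StrongDual ℂ X) :=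
  f ∘L M.bidualLeft g

/-- The second Arens product `(f ⋄ g) ω = g (ω_f)`. -/
def arensDiamond (f g : StrongDual ℂ (StrongDual ℂ X)) : StrongDual ℂ (StrongDual ℂ X) :=
  g ∘L M.bidualRight f

/-- Arens regularity: the two Arens products agree on the bidual. -/
def IsArensRegular : Prop := ∀ f g, M.arensBox f g = M.arensDiamond f g

/-- The left topological centre of the bidual. -/
def leftTopologicalCenter : Set (StrongDual ℂ (StrongDual ℂ X)) :=
  {φ | ∀ ψ, M.arensBox φ ψ = M.arensDiamond φ ψ}

/-- The right topological centre of the bidual. -/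
def rightTopologicalCenter : Set (StrongDual ℂ (StrongDual ℂ X)) :=
  {φ | ∀ ψ, M.arensBox ψ φ = M.arensDiamond ψ φ}

/-- Left strong Arens irregularity: the left topological centre is the canonical copy of `X`. -/
def IsLeftStronglyArensIrregular : Prop :=
  M.leftTopologicalCenter = Set.range (NormedSpace.inclusionInDoubleDual ℂ X)

/-- Right strong Arens irregularity: the right topological centre is the canonical copy of `X`. -/
def IsRightStronglyArensIrregular : Prop :=
  M.rightTopologicalCenter = Set.range (NormedSpace.inclusionInDoubleDual ℂ X)

/-- Strong Arens irregularity: both left and right strong Arens irregularity. -/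
def IsStronglyArensIrregular : Prop :=
  M.IsLeftStronglyArensIrregular ∧ M.IsRightStronglyArensIrregular

end Arens

section ProjTensor

variable (M : BanachAlgebraStructure X) (N : BanachAlgebraStructure Y)

/-- The multiplication of the algebraic tensor product,
`(a ⊗ b) (a' ⊗ b') = (a a') ⊗ (b b')`. -/
def algTensorMulₗ : AlgTensor X Y →ₗ[ℂ] AlgTensor X Y →ₗ[ℂ] AlgTensor X Y :=
  TensorProduct.map₂ (ContinuousLinearMap.toLinearMap₁₂ M.mul)
    (ContinuousLinearMap.toLinearMap₁₂ N.mul)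

theorem algTensorMulₗ_tmul (a a' : X) (b b' : Y) :
    algTensorMulₗ M N (AlgTensor.tmul a b) (AlgTensor.tmul a' b') =
      AlgTensor.tmul (M.mul a a') (N.mul b b') := rfl

theorem norm_algTensorMulₗ_le (u v : AlgTensor X Y) :
    ‖algTensorMulₗ M N u v‖ ≤ ‖u‖ * ‖v‖ := by
  refine AlgTensor.bound_of_tmul (algTensorMulₗ M N u) (norm_nonneg u) (fun a' b' => ?_) v
  rw [mul_comm]
  refine AlgTensor.bound_of_tmul ((algTensorMulₗ M N).flip (AlgTensor.tmul a' b'))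
    (by positivity) (fun a b => ?_) u
  rw [LinearMap.flip_apply, algTensorMulₗ_tmul]
  refine (AlgTensor.norm_tmul_le _ _).trans ?_
  calc ‖M.mul a a'‖ * ‖N.mul b b'‖ ≤ (‖a‖ * ‖a'‖) * (‖b‖ * ‖b'‖) :=
        mul_le_mul (M.norm_mul_le _ _) (N.norm_mul_le _ _) (norm_nonneg _) (by positivity)
    _ = ‖a'‖ * ‖b'‖ * (‖a‖ * ‖b‖) := by ring

theorem algTensorMulₗ_assoc (u v w : AlgTensor X Y) :
    algTensorMulₗ M N (algTensorMulₗ M N u v) w =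
      algTensorMulₗ M N u (algTensorMulₗ M N v w) := by
  induction u using AlgTensor.induction_on with
  | zero => simp only [LinearMap.map_zero, LinearMap.zero_apply]
  | add u u' hu hu' => simp only [LinearMap.map_add, LinearMap.add_apply, hu, hu']
  | tmul a b =>
    induction v using AlgTensor.induction_on with
    | zero => simp only [LinearMap.map_zero, LinearMap.zero_apply]
    | add v v' hv hv' => simp only [LinearMap.map_add, LinearMap.add_apply, hv, hv']
    | tmul a' b' =>
      induction w using AlgTensor.induction_on with
      | zero => simp only [LinearMap.map_zero]
      | add w w' hw hw' => simp only [LinearMap.map_add, hw, hw']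
      | tmul a'' b'' =>
        change AlgTensor.tmul (M.mul (M.mul a a') a'') (N.mul (N.mul b b') b'') =
          AlgTensor.tmul (M.mul a (M.mul a' a'')) (N.mul b (N.mul b' b''))
        rw [M.mul_assoc, N.mul_assoc]

/-- The multiplication of the algebraic tensor product, with values in the completion. -/
def algTensorMul : AlgTensor X Y →L[ℂ] AlgTensor X Y →L[ℂ] ProjTensor X Y :=
  LinearMap.mkContinuous₂
    ((algTensorMulₗ M N).compr₂
      (ProjTensor.coeL X Y).toLinearMap) 1
    (fun u v => by
      rw [one_mul]
      exact (UniformSpace.Completion.norm_coe (algTensorMulₗ M N u v)).trans_le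
        (norm_algTensorMulₗ_le M N u v))

/-- The continuous extension of the multiplication to the completion. -/
def projTensorMul : ProjTensor X Y →L[ℂ] ProjTensor X Y →L[ℂ] ProjTensor X Y :=
  (((algTensorMul M N).extend (ProjTensor.coeL X Y)).flip.extend (ProjTensor.coeL X Y)).flip

theorem projTensorMul_coe (u v : AlgTensor X Y) :
    projTensorMul M N u v = (algTensorMulₗ M N u v : AlgTensor X Y) := by
  have hd : DenseRange (ProjTensor.coeL X Y) := UniformSpace.Completion.denseRange_coe
  have hi : IsUniformInducing (ProjTensor.coeL X Y) :=
    UniformSpace.Completion.isUniformInducing_coe _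
  have h1 := ContinuousLinearMap.extend_eq (algTensorMul M N) hd hi u
  have h2 := ContinuousLinearMap.extend_eq
    ((algTensorMul M N).extend (ProjTensor.coeL X Y)).flip hd hi v
  change (((algTensorMul M N).extend (ProjTensor.coeL X Y)).flip.extend (ProjTensor.coeL X Y))
    (ProjTensor.coeL X Y v) (ProjTensor.coeL X Y u) = _
  rw [h2, ContinuousLinearMap.flip_apply, h1]
  rfl

/-- The Banach algebra `X ⊗^γ Y`, with `(a ⊗ b) (a' ⊗ b') = (a a') ⊗ (b b')`. -/
def projTensor : BanachAlgebraStructure (ProjTensor X Y) where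
  mul := projTensorMul M N
  mul_assoc u v w := by
    induction u, v, w using UniformSpace.Completion.induction_on₃ with
    | hp => exact isClosed_eq (by fun_prop) (by fun_prop)
    | ih u v w => simp only [projTensorMul_coe, algTensorMulₗ_assoc]
  norm_mul_le u v := by
    induction u, v using UniformSpace.Completion.induction_on₂ with
    | hp => exact isClosed_le (by fun_prop) (by fun_prop)
    | ih u v =>
      rw [projTensorMul_coe, UniformSpace.Completion.norm_coe, UniformSpace.Completion.norm_coe,
        UniformSpace.Completion.norm_coe]
      exact norm_algTensorMulₗ_le M N u v

theorem projTensor_mul_tmul (a a' : X) (b b' : Y) :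
    (projTensor M N).mul (ProjTensor.tmul a b) (ProjTensor.tmul a' b') =
      ProjTensor.tmul (M.mul a a') (N.mul b b') := by
  change projTensorMul M N _ _ = _
  rw [ProjTensor.tmul, ProjTensor.tmul, projTensorMul_coe, algTensorMulₗ_tmul]
  rfl

end ProjTensor

end BanachAlgebraStructure

end BanachAlgebra

section HilbertSchmidtAlgebra

variable (H : Type*) [NormedAddCommGroup H] [InnerProductSpace ℂ H] [CompleteSpace H]

/-- The Banach algebra `S₂(H)` of Hilbert–Schmidt operators under composition. -/
def hilbertSchmidtAlgebra : BanachAlgebraStructure (HilbertSchmidt H) where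
  mul := LinearMap.mkContinuous₂ (LinearMap.mk₂ ℂ (fun S T => S * T)
      (fun S S' T => by ext1; simp [add_mul]) (fun c S T => by ext1; simp)
      (fun S T T' => by ext1; simp [mul_add]) (fun c S T => by ext1; simp)) 1
    (fun S T => by rw [one_mul]; exact HilbertSchmidt.norm_mul_le S T)
  mul_assoc R S T := by
    change R * S * T = R * (S * T)
    ext1
    simp [mul_assoc]
  norm_mul_le := HilbertSchmidt.norm_mul_le

theorem hilbertSchmidtAlgebra_mul (S T : HilbertSchmidt H) :
    (hilbertSchmidtAlgebra H).mul S T = S * T := rfl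

open InnerProductSpace in
/-- The Banach algebra `S₂(H)*`, where the product of the functionals represented by `S` and `T`
is the functional represented by `S * T`. -/
def hilbertSchmidtDualAlgebra : BanachAlgebraStructure (StrongDual ℂ (HilbertSchmidt H)) where
  mul := LinearMap.mkContinuous₂ (LinearMap.mk₂ ℂ
      (fun φ ψ => toDual ℂ (HilbertSchmidt H) ((hilbertSchmidtAlgebra H).mul
        ((toDual ℂ (HilbertSchmidt H)).symm φ) ((toDual ℂ (HilbertSchmidt H)).symm ψ)))
      (fun φ φ' ψ => by simp only [map_add, add_apply])
      (fun c φ ψ => by simp only [map_smulₛₗ, smul_apply,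
        RingHomCompTriple.comp_apply, RingHom.id_apply])
      (fun φ ψ ψ' => by simp only [map_add])
      (fun c φ ψ => by simp only [map_smulₛₗ, RingHom.id_apply, Complex.conj_conj])) 1
    (fun φ ψ => by
      rw [one_mul, LinearMap.mk₂_apply, LinearIsometryEquiv.norm_map]
      simpa using (hilbertSchmidtAlgebra H).norm_mul_le
        ((toDual ℂ (HilbertSchmidt H)).symm φ) ((toDual ℂ (HilbertSchmidt H)).symm ψ))
  mul_assoc φ ψ χ := by simp [(hilbertSchmidtAlgebra H).mul_assoc]
  norm_mul_le φ ψ := by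
    rw [LinearMap.mkContinuous₂_apply, LinearMap.mk₂_apply, LinearIsometryEquiv.norm_map]
    simpa using (hilbertSchmidtAlgebra H).norm_mul_le
      ((toDual ℂ (HilbertSchmidt H)).symm φ) ((toDual ℂ (HilbertSchmidt H)).symm ψ)

open InnerProductSpace in
theorem hilbertSchmidtDualAlgebra_mul_toDual (S T : HilbertSchmidt H) :
    (hilbertSchmidtDualAlgebra H).mul (toDual ℂ _ S) (toDual ℂ _ T) = toDual ℂ _ (S * T) := by
  change toDual ℂ _ ((hilbertSchmidtAlgebra H).mul _ _) = _
  rw [LinearIsometryEquiv.symm_apply_apply, LinearIsometryEquiv.symm_apply_apply]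
  rfl

end HilbertSchmidtAlgebra

end Predual

end

/-!
The map `φ ⊗ y ↦ φ(·) y` is an isometric isomorphism of `H* ⊗^γ H` onto `S₁(H)`. It is injective
because truncation of the second factor to finitely many basis vectors approximates every tensor
(`tendsto_map_partialSum`), so a tensor is determined by its operator (`toOperator_injective`). It
is surjective without loss of norm because `T = W R R`, with `R = |T| ^ (1 / 2)` and `W` a
contraction, is the sum of the rank one operators `⟪R eᵢ, ·⟫ W R eᵢ`, and `∑ ‖R eᵢ‖ ^ 2 = Tr |T|`
(`exists_tensor_of_traceClass`). A bounded functional on `H* ⊗^γ H` is `φ ⊗ y ↦ φ (B y)` for a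
bounded operator `B`; on trace class operators this is the trace pairing, and truncation evaluates
it as `∑ ⟪eₙ, B T eₙ⟫` in every orthonormal basis.

Matrix units form an orthonormal basis of `K = S₂(H)`, so `K` is separable and infinite-dimensional
and unitarily equivalent to `H`. With `J` the complex conjugation in an orthonormal basis of `H`,
the Riesz identification followed by `T ↦ J T J` is a multiplicative isometry of `K*` onto `K`;
tensoring it with the identity gives `K* ⊗^γ K ≅ K ⊗^γ K`.

Write `eᵢⱼ` for the matrix units and `tᵢⱼ = eᵢⱼ* ⊗ eᵢⱼ` in `K* ⊗^γ K`,
where `S*` is the functional represented by `S`. Then `tᵢ₀ t₀ⱼ = tᵢⱼ`, and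
the bounded functional `S* ⊗ T ↦ ⟪S, D T⟫`, with `D` the projection onto the upper triangular
operators, is `1` at `tᵢⱼ` if `i ≤ j` and `0` otherwise. Its iterated limits in `i` and `j` differ,
so the algebra is not Arens regular. On the other hand right multiplication by `tₙ₀` only sees the
`n`-th columns of the two factors, whence `∑ₙ ‖b tₙ₀‖ ≤ ‖b‖` for all `b`. Therefore a weak* cluster
point `φ` of `(tₙ₀)` satisfies `ψ □ φ = 0 = ψ ⋄ φ` for all `ψ` in the bidual
(`not_isRightStronglyArensIrregular_of_seq`). It is not in the algebra: all matrix coefficients tend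
to zero along `(tₙ₀)`, so it would be `0`, but `S* ⊗ T ↦ ⟪S, T⟫` is `1` along the sequence.
-/

noncomputable section

namespace Predual

/-! ### Dual spaces and bounded maps on projective tensor products -/

/-- The isometric isomorphism `φ ↦ φ ∘ V⁻¹` of the dual spaces. -/
def dualCongr {E F : Type*} [NormedAddCommGroup E] [NormedSpace ℂ E] [NormedAddCommGroup F]
    [NormedSpace ℂ F] (V : E ≃ₗᵢ[ℂ] F) : StrongDual ℂ E ≃ₗᵢ[ℂ] StrongDual ℂ F where
  toFun φ := φ ∘L (V.symm.toContinuousLinearEquiv : F →L[ℂ] E)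
  map_add' _ _ := rfl
  map_smul' _ _ := rfl
  invFun φ := φ ∘L (V.toContinuousLinearEquiv : E →L[ℂ] F)
  left_inv φ := by ext x; simp
  right_inv φ := by ext x; simp
  norm_map' φ := ContinuousLinearMap.opNorm_comp_linearIsometryEquiv φ V.symm

namespace ProjTensor

variable {E F G : Type*} [NormedAddCommGroup E] [NormedSpace ℂ E]
  [NormedAddCommGroup F] [NormedSpace ℂ F] [NormedAddCommGroup G] [NormedSpace ℂ G]

theorem norm_tmul_le (x : E) (y : F) : ‖tmul x y‖ ≤ ‖x‖ * ‖y‖ :=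
  (UniformSpace.Completion.norm_coe (AlgTensor.tmul x y)).trans_le (AlgTensor.norm_tmul_le x y)

theorem clm_ext {f g : ProjTensor E F →L[ℂ] G} (h : ∀ x y, f (tmul x y) = g (tmul x y)) :
    f = g := by
  ext u
  induction u using UniformSpace.Completion.induction_on with
  | hp => exact isClosed_eq f.continuous g.continuous
  | ih u =>
    induction u using AlgTensor.induction_on with
    | zero => rw [UniformSpace.Completion.coe_zero, map_zero, map_zero]
    | tmul x y => exact h x y
    | add u v hu hv => rw [UniformSpace.Completion.coe_add, map_add, map_add, hu, hv]

theorem norm_apply_le_of_tmul {C : ℝ} (hC : 0 ≤ C) (f : ProjTensor E F →L[ℂ] G)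
    (hf : ∀ x y, ‖f (tmul x y)‖ ≤ C * (‖x‖ * ‖y‖)) (u : ProjTensor E F) : ‖f u‖ ≤ C * ‖u‖ := by
  induction u using UniformSpace.Completion.induction_on with
  | hp => exact isClosed_le (by fun_prop) (by fun_prop)
  | ih u =>
    refine (AlgTensor.bound_of_tmul (f.toLinearMap ∘ₗ (coeL E F).toLinearMap) hC hf u).trans_eq ?_
    exact congrArg (C * ·) (UniformSpace.Completion.norm_coe u).symm

theorem sum_norm_apply_le_of_tmul {ι : Type*} (s : Finset ι) (f : ι → ProjTensor E F →L[ℂ] G)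
    (hf : ∀ x y, ∑ i ∈ s, ‖f i (tmul x y)‖ ≤ ‖x‖ * ‖y‖) (u : ProjTensor E F) :
    ∑ i ∈ s, ‖f i u‖ ≤ ‖u‖ := by
  let g : ProjTensor E F →L[ℂ] PiLp 1 fun _ : s => G :=
    (PiLp.continuousLinearEquiv 1 ℂ fun _ : s => G).symm.toContinuousLinearMap ∘L
      ContinuousLinearMap.pi fun i : s => f i
  have hg : ∀ v, ‖g v‖ = ∑ i ∈ s, ‖f i v‖ := fun v => by
    rw [PiLp.norm_eq_of_L1, ← Finset.sum_coe_sort s]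
    rfl
  rw [← hg, ← one_mul ‖u‖]
  refine norm_apply_le_of_tmul zero_le_one g (fun x y => ?_) u
  rw [hg, one_mul]
  exact hf x y

/-- The elementary tensor as a bounded bilinear map. -/
def tmulL : E →L[ℂ] F →L[ℂ] ProjTensor E F :=
  LinearMap.mkContinuous₂ ((TensorProduct.mk ℂ E F).compr₂ (coeL E F).toLinearMap) 1
    fun x y => by rw [one_mul]; exact norm_tmul_le x y

theorem tmulL_apply (x : E) (y : F) : tmulL x y = tmul x y := rfl

theorem tmul_smul (c : ℂ) (x : E) (y : F) : tmul x (c • y) = tmul (c • x) y := by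
  rw [← tmulL_apply, ← tmulL_apply, map_smul, map_smul, smul_apply]

theorem tmul_sum {ι : Type*} (s : Finset ι) (x : E) (y : ι → F) :
    tmul x (∑ i ∈ s, y i) = ∑ i ∈ s, tmul x (y i) :=
  map_sum (tmulL x) y s

variable [CompleteSpace G]

/-- The bounded linear map on `E ⊗^γ F` that linearizes a bounded bilinear map. -/
def lift (f : E →L[ℂ] F →L[ℂ] G) : ProjTensor E F →L[ℂ] G :=
  ContinuousLinearMap.extend
    (LinearMap.mkContinuous (TensorProduct.lift (ContinuousLinearMap.toLinearMap₁₂ f) :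
      AlgTensor E F →ₗ[ℂ] G) ‖f‖ fun u =>
        AlgTensor.bound_of_tmul _ (norm_nonneg f) (fun x y => by
          rw [← mul_assoc]; exact f.le_opNorm₂ x y) u)
    (coeL E F)

@[simp]
theorem lift_tmul (f : E →L[ℂ] F →L[ℂ] G) (x : E) (y : F) : lift f (tmul x y) = f x y :=
  ContinuousLinearMap.extend_eq _ UniformSpace.Completion.denseRange_coe
    (UniformSpace.Completion.isUniformInducing_coe _) (AlgTensor.tmul x y)

variable {E' F' : Type*} [NormedAddCommGroup E'] [NormedSpace ℂ E']
  [NormedAddCommGroup F'] [NormedSpace ℂ F']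

/-- The tensor product `f ⊗ g` of bounded operators. -/
def map (f : E →L[ℂ] E') (g : F →L[ℂ] F') : ProjTensor E F →L[ℂ] ProjTensor E' F' :=
  lift (tmulL.bilinearComp f g)

@[simp]
theorem map_tmul (f : E →L[ℂ] E') (g : F →L[ℂ] F') (x : E) (y : F) :
    map f g (tmul x y) = tmul (f x) (g y) := by
  rw [map, lift_tmul]; rfl

theorem norm_map_apply_le {f : E →L[ℂ] E'} {g : F →L[ℂ] F'} (hf : ∀ x, ‖f x‖ ≤ ‖x‖)
    (hg : ∀ y, ‖g y‖ ≤ ‖y‖) (u : ProjTensor E F) : ‖map f g u‖ ≤ ‖u‖ := by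
  rw [← one_mul ‖u‖]
  refine norm_apply_le_of_tmul zero_le_one _ (fun x y => ?_) u
  rw [map_tmul, one_mul]
  exact (norm_tmul_le _ _).trans (mul_le_mul (hf x) (hg y) (norm_nonneg _) (norm_nonneg _))

/-- The tensor product of two surjective isometries is a surjective isometry. -/
def congr (f : E ≃ₗᵢ[ℂ] E') (g : F ≃ₗᵢ[ℂ] F') : ProjTensor E F ≃ₗᵢ[ℂ] ProjTensor E' F' :=
  have hl : ∀ u, map (f.symm : E' →L[ℂ] E) (g.symm : F' →L[ℂ] F)
      (map (f : E →L[ℂ] E') (g : F →L[ℂ] F') u) = u := DFunLike.congr_fun (clm_ext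
    (f := map (f.symm : E' →L[ℂ] E) (g.symm : F' →L[ℂ] F) ∘L
      map (f : E →L[ℂ] E') (g : F →L[ℂ] F')) (g := .id ℂ _) fun x y => by simp)
  have hr : ∀ u, map (f : E →L[ℂ] E') (g : F →L[ℂ] F')
      (map (f.symm : E' →L[ℂ] E) (g.symm : F' →L[ℂ] F) u) = u := DFunLike.congr_fun (clm_ext
    (f := map (f : E →L[ℂ] E') (g : F →L[ℂ] F') ∘L
      map (f.symm : E' →L[ℂ] E) (g.symm : F' →L[ℂ] F)) (g := .id ℂ _) fun x y => by simp)
  { toFun := map (f : E →L[ℂ] E') (g : F →L[ℂ] F')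
    map_add' := map_add _
    map_smul' := map_smul _
    invFun := map (f.symm : E' →L[ℂ] E) (g.symm : F' →L[ℂ] F)
    left_inv := hl
    right_inv := hr
    norm_map' := fun u => by
      refine le_antisymm (norm_map_apply_le (fun x => (f.norm_map x).le)
        (fun y => (g.norm_map y).le) u) ?_
      have := norm_map_apply_le (f := (f.symm : E' →L[ℂ] E)) (g := (g.symm : F' →L[ℂ] F))
        (fun x => (f.symm.norm_map x).le) (fun y => (g.symm.norm_map y).le)
        (map (f : E →L[ℂ] E') (g : F →L[ℂ] F') u)
      rwa [hl u] at this }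

@[simp]
theorem congr_tmul (f : E ≃ₗᵢ[ℂ] E') (g : F ≃ₗᵢ[ℂ] F') (x : E) (y : F) :
    congr f g (tmul x y) = tmul (f x) (g y) :=
  map_tmul (f : E →L[ℂ] E') (g : F →L[ℂ] F') x y

theorem congr_mul [CompleteSpace E] [CompleteSpace F] [CompleteSpace E'] [CompleteSpace F']
    {M : BanachAlgebraStructure E} {N : BanachAlgebraStructure F}
    {M' : BanachAlgebraStructure E'} {N' : BanachAlgebraStructure F'}
    {f : E ≃ₗᵢ[ℂ] E'} {g : F ≃ₗᵢ[ℂ] F'} (hf : ∀ a b, f (M.mul a b) = M'.mul (f a) (f b))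
    (hg : ∀ a b, g (N.mul a b) = N'.mul (g a) (g b)) (u v : ProjTensor E F) :
    congr f g ((M.projTensor N).mul u v) =
      (M'.projTensor N').mul (congr f g u) (congr f g v) := by
  let c : ProjTensor E F →L[ℂ] ProjTensor E' F' := (congr f g : _ →L[ℂ] _)
  have h : ContinuousLinearMap.compL ℂ _ _ _ c ∘L (M.projTensor N).mul =
      (M'.projTensor N').mul.bilinearComp c c := by
    refine clm_ext fun a b => clm_ext fun a' b' => ?_
    change congr f g ((M.projTensor N).mul (tmul a b) (tmul a' b')) =
      (M'.projTensor N').mul (congr f g (tmul a b)) (congr f g (tmul a' b'))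
    simp only [BanachAlgebraStructure.projTensor_mul_tmul, congr_tmul, hf, hg]
  exact DFunLike.congr_fun (DFunLike.congr_fun h u) v

/-! ### Tensors as operators, and the approximation property of Hilbert spaces -/

/-- The operator `z ↦ ∑ φᵢ(z) yᵢ` defined by a tensor `∑ φᵢ ⊗ yᵢ` in `E* ⊗^γ G`. -/
def toOperator : ProjTensor (StrongDual ℂ E) G →L[ℂ] E →L[ℂ] G :=
  lift (ContinuousLinearMap.smulRightL ℂ E G)

@[simp]
theorem toOperator_tmul (φ : StrongDual ℂ E) (y : G) : toOperator (tmul φ y) = φ.smulRight y :=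
  lift_tmul _ _ _

/-- The functional `φ ⊗ y ↦ φ (B y)` on `E* ⊗^γ F`. -/
def pairing (B : F →L[ℂ] E) : StrongDual ℂ (ProjTensor (StrongDual ℂ E) F) :=
  lift ((ContinuousLinearMap.compL ℂ F E ℂ).flip B)

@[simp]
theorem pairing_tmul (B : F →L[ℂ] E) (φ : StrongDual ℂ E) (y : F) :
    pairing B (tmul φ y) = φ (B y) :=
  lift_tmul _ _ _

end ProjTensor

section Approximation

variable {E H : Type*} [NormedAddCommGroup E] [NormedSpace ℂ E]
  [NormedAddCommGroup H] [InnerProductSpace ℂ H]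

/-- The partial sum `y ↦ ∑ i ∈ s, ⟪eᵢ, y⟫ eᵢ` of an orthonormal expansion. -/
def partialSum {ι : Type*} (e : HilbertBasis ι ℂ H) (s : Finset ι) : H →L[ℂ] H :=
  ∑ i ∈ s, (innerSL ℂ (e i)).smulRight (e i)

theorem partialSum_apply {ι : Type*} (e : HilbertBasis ι ℂ H) (s : Finset ι) (y : H) :
    partialSum e s y = ∑ i ∈ s, ⟪e i, y⟫_ℂ • e i := by
  simp [partialSum]

theorem norm_partialSum_apply_le {ι : Type*} (e : HilbertBasis ι ℂ H) (s : Finset ι) (y : H) :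
    ‖partialSum e s y‖ ≤ ‖y‖ := by
  refine le_of_sq_le_sq ?_ (norm_nonneg _)
  rw [partialSum_apply, ← inner_self_eq_norm_sq (𝕜 := ℂ), e.orthonormal.inner_sum, map_sum]
  refine le_of_eq_of_le (Finset.sum_congr rfl fun i _ => ?_)
    (e.orthonormal.sum_inner_products_le y (s := s))
  rw [RCLike.conj_mul]
  norm_cast

/-- Truncating the second factor to finitely many basis vectors approximates every tensor; this is
the metric approximation property of a Hilbert space. -/
theorem tendsto_map_partialSum {ι : Type*} (e : HilbertBasis ι ℂ H) (u : ProjTensor E H) :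
    Filter.Tendsto (fun s => ProjTensor.map (.id ℂ E) (partialSum e s) u) Filter.atTop
      (nhds u) := by
  have heq : Equicontinuous fun s : Finset ι =>
      (ProjTensor.map (.id ℂ E) (partialSum e s) : ProjTensor E H → ProjTensor E H) := by
    refine (LipschitzWith.uniformEquicontinuous _ 1 fun s => ?_).equicontinuous
    refine AddMonoidHomClass.lipschitz_of_bound_nnnorm _ 1 fun u => ?_
    rw [one_mul]
    exact ProjTensor.norm_map_apply_le (fun _ => le_rfl) (norm_partialSum_apply_le e s) u
  induction u using UniformSpace.Completion.induction_on with
  | hp => exact heq.isClosed_setOfPred_tendsto continuous_id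
  | ih u =>
    induction u using AlgTensor.induction_on with
    | zero => simp only [UniformSpace.Completion.coe_zero, map_zero, tendsto_const_nhds]
    | tmul x y =>
      change Filter.Tendsto (fun s => ProjTensor.map (.id ℂ E) (partialSum e s)
        (ProjTensor.tmul x y)) _ (nhds (ProjTensor.tmul x y))
      simp only [ProjTensor.map_tmul, ContinuousLinearMap.id_apply, partialSum_apply]
      have := e.hasSum_repr y
      simp only [e.repr_apply_apply] at this
      exact ((ProjTensor.tmulL x).continuous.tendsto y).comp this
    | add u v hu hv =>
      simp only [UniformSpace.Completion.coe_add, map_add]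
      exact hu.add hv

/-- A tensor in `E* ⊗^γ H` with `H` a Hilbert space is determined by its operator: the `i`-th row of
the operator determines the part of the tensor with second factor `eᵢ`, and these parts determine
the tensor by the approximation property. -/
theorem toOperator_injective [CompleteSpace H] :
    Function.Injective (ProjTensor.toOperator : ProjTensor (StrongDual ℂ E) H →L[ℂ] E →L[ℂ] H) := by
  refine (injective_iff_map_eq_zero _).2 fun u hu => ?_
  let e := stdBasis H
  have key : ∀ i, ProjTensor.map (.id ℂ (StrongDual ℂ E)) ((innerSL ℂ (e i)).smulRight (e i)) =
      (ProjTensor.tmulL.flip (e i)) ∘L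
        (ContinuousLinearMap.compL ℂ E H ℂ (innerSL ℂ (e i))) ∘L ProjTensor.toOperator :=
    fun i => ProjTensor.clm_ext fun φ y => by
      simp only [ProjTensor.map_tmul, ContinuousLinearMap.comp_apply, ProjTensor.toOperator_tmul,
        ContinuousLinearMap.flip_apply, ContinuousLinearMap.compL_apply,
        ContinuousLinearMap.smulRight_apply, ContinuousLinearMap.id_apply,
        ProjTensor.tmulL_apply, ProjTensor.tmul_smul]
      congr 1
      ext z
      simp [mul_comm]
  have hs : ∀ s, ProjTensor.map (.id ℂ (StrongDual ℂ E)) (partialSum e s) =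
      ∑ i ∈ s, ProjTensor.map (.id ℂ (StrongDual ℂ E)) ((innerSL ℂ (e i)).smulRight (e i)) :=
    fun s => ProjTensor.clm_ext fun φ y => by
      simp only [ProjTensor.map_tmul, partialSum, sum_apply, ProjTensor.tmul_sum]
  have h0 : ∀ s, ProjTensor.map (.id ℂ (StrongDual ℂ E)) (partialSum e s) u = 0 := fun s => by
    rw [hs, sum_apply]
    refine Finset.sum_eq_zero fun i _ => ?_
    rw [key, ContinuousLinearMap.comp_apply, ContinuousLinearMap.comp_apply, hu, map_zero, map_zero]
  refine tendsto_nhds_unique (tendsto_map_partialSum e u) ?_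
  simp only [h0, tendsto_const_nhds]

end Approximation

/-! ### Trace class operators as tensors -/

section TraceClassTensor

variable {H : Type*} [NormedAddCommGroup H] [InnerProductSpace ℂ H] [CompleteSpace H]

theorem hasSum_inner_smulRight {ι : Type*} (e : HilbertBasis ι ℂ H) (φ : StrongDual ℂ H) (y : H) :
    HasSum (fun i => ⟪e i, φ.smulRight y (e i)⟫_ℂ) (φ y) := by
  have h := e.hasSum_inner_mul_inner ((InnerProductSpace.toDual ℂ H).symm φ) y
  simpa only [InnerProductSpace.toDual_symm_apply, ContinuousLinearMap.smulRight_apply,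
    inner_smul_right] using h

/-- The trace norm of a rank one operator. With `|T| = U T` for a contraction `U`, the trace of
`|T| = φ(·) U y` is `φ (U y)`. -/
theorem schattenENorm_one_smulRight_le (φ : StrongDual ℂ H) (y : H) :
    schattenENorm 1 (φ.smulRight y) ≤ ENNReal.ofReal (‖φ‖ * ‖y‖) := by
  set T : H →L[ℂ] H := φ.smulRight y with hT
  obtain ⟨U, hU, hUT⟩ := exists_contraction (A := T) (B := CFC.abs T)
    fun x => (norm_abs_apply T x).le
  have hUT' : CFC.abs T = φ.smulRight (U y) := by
    rw [← hUT]
    ext x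
    simp [hT]
  have hs := hasSum_inner_smulRight (stdBasis H) φ (U y)
  rw [← hUT'] at hs
  have hs' := RCLike.hasSum_re ℂ hs
  have hpos : ∀ i, 0 ≤ RCLike.re ⟪stdBasis H i, CFC.abs T (stdBasis H i)⟫_ℂ := fun i =>
    ((ContinuousLinearMap.nonneg_iff_isPositive _).1 (CFC.abs_nonneg T)).re_inner_nonneg_right _
  rw [schattenENorm_one, opTrace, ← ENNReal.ofReal_tsum_of_nonneg hpos hs'.summable, hs'.tsum_eq]
  refine ENNReal.ofReal_le_ofReal ((RCLike.re_le_norm _).trans ((φ.le_opNorm _).trans ?_))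
  gcongr
  exact (U.le_opNorm y).trans (mul_le_of_le_one_left (norm_nonneg _) hU)

/-- The rank one operator `z ↦ φ(z) y`, as a trace class operator. -/
def rankOneTraceClass (φ : StrongDual ℂ H) (y : H) : TraceClass H :=
  .mk (φ.smulRight y)
    (ne_top_of_le_ne_top ENNReal.ofReal_ne_top (schattenENorm_one_smulRight_le φ y))

theorem norm_rankOneTraceClass_le (φ : StrongDual ℂ H) (y : H) :
    ‖rankOneTraceClass φ y‖ ≤ ‖φ‖ * ‖y‖ :=
  ENNReal.toReal_le_of_le_ofReal (by positivity) (schattenENorm_one_smulRight_le φ y)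

variable (H) in
/-- The trace class operator defined by a tensor. -/
def tensorToTraceClass : ProjTensor (StrongDual ℂ H) H →L[ℂ] TraceClass H :=
  ProjTensor.lift <| LinearMap.mkContinuous₂ (LinearMap.mk₂ ℂ rankOneTraceClass
      (fun φ ψ y => by ext1; ext z; simp [rankOneTraceClass, add_smul])
      (fun c φ y => by ext1; ext z; simp [rankOneTraceClass, mul_smul])
      (fun φ y y' => by ext1; ext z; simp [rankOneTraceClass])
      (fun c φ y => by ext1; ext z; exact smul_comm (φ z) c y)) 1
    fun φ y => by rw [one_mul]; exact norm_rankOneTraceClass_le φ y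

theorem tensorToTraceClass_tmul (φ : StrongDual ℂ H) (y : H) :
    tensorToTraceClass H (ProjTensor.tmul φ y) = rankOneTraceClass φ y :=
  ProjTensor.lift_tmul _ _ _

theorem norm_tensorToTraceClass_le (u : ProjTensor (StrongDual ℂ H) H) :
    ‖tensorToTraceClass H u‖ ≤ ‖u‖ := by
  rw [← one_mul ‖u‖]
  refine ProjTensor.norm_apply_le_of_tmul zero_le_one _ (fun φ y => ?_) u
  rw [tensorToTraceClass_tmul, one_mul]
  exact norm_rankOneTraceClass_le φ y

theorem toOp_tensorToTraceClass (u : ProjTensor (StrongDual ℂ H) H) :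
    TraceClass.toOp (tensorToTraceClass H u) = ProjTensor.toOperator u := by
  have h : TraceClass.toOpL ∘L tensorToTraceClass H = ProjTensor.toOperator :=
    ProjTensor.clm_ext fun φ y => by
      rw [ContinuousLinearMap.comp_apply, tensorToTraceClass_tmul, ProjTensor.toOperator_tmul]
      rfl
  exact DFunLike.congr_fun h u

theorem tensorToTraceClass_injective : Function.Injective (tensorToTraceClass H) := fun u v h =>
  toOperator_injective (by rw [← toOp_tensorToTraceClass, h, toOp_tensorToTraceClass])

/-- With `R = |T| ^ (1 / 2)` and `T = W |T|` for a contraction `W`, the operator `T = W R R` is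
`∑ ⟪R eᵢ, ·⟫ W R eᵢ`, and this series has total cost at most `∑ ‖R eᵢ‖ ^ 2 = Tr |T|`. -/
theorem exists_tensor_of_traceClass (T : TraceClass H) :
    ∃ u, ‖u‖ ≤ ‖T‖ ∧ tensorToTraceClass H u = T := by
  set A := TraceClass.toOp T with hA
  obtain ⟨W, hW, hWA⟩ := exists_contraction (A := CFC.abs A) (B := A)
    fun x => (norm_abs_apply A x).ge
  set R := CFC.sqrt (CFC.abs A) with hR
  have hRR : R * R = CFC.abs A := CFC.sqrt_mul_sqrt_self _ (CFC.abs_nonneg A)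
  have hRs : star R = R := (IsSelfAdjoint.of_nonneg (CFC.sqrt_nonneg _)).star_eq
  set e := stdBasis H
  have hsum : HasSum (fun i => ‖R (e i)‖ ^ 2) ‖T‖ := by
    have h1 : ∑' i, ENNReal.ofReal (‖R (e i)‖ ^ 2) = ENNReal.ofReal ‖T‖ := by
      rw [← T.schattenENorm_eq_ofReal, schattenENorm_one_eq_hsSum e]
      refine tsum_congr fun i => ?_
      rw [ENNReal.ofReal_pow (norm_nonneg _), ofReal_norm]
    have h2 : Summable fun i => ‖R (e i)‖ ^ 2 := by
      have := ENNReal.summable_toReal (h1.trans_ne ENNReal.ofReal_ne_top)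
      simpa only [ENNReal.toReal_ofReal (sq_nonneg _)] using this
    rw [← ENNReal.ofReal_tsum_of_nonneg (fun i => sq_nonneg _) h2,
      ENNReal.ofReal_eq_ofReal_iff (tsum_nonneg fun i => sq_nonneg _) (norm_nonneg _)] at h1
    exact h1 ▸ h2.hasSum
  let f : BasisIndex H → ProjTensor (StrongDual ℂ H) H := fun i =>
    ProjTensor.tmul (innerSL ℂ (R (e i))) (W (R (e i)))
  have hf : ∀ i, ‖f i‖ ≤ ‖R (e i)‖ ^ 2 := fun i => by
    refine (ProjTensor.norm_tmul_le _ _).trans ?_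
    rw [innerSL_apply_norm, sq]
    gcongr
    exact (W.le_opNorm _).trans (mul_le_of_le_one_left (norm_nonneg _) hW)
  have hfs : Summable f := .of_norm_bounded hsum.summable hf
  refine ⟨∑' i, f i, tsum_of_norm_bounded hsum hf, ?_⟩
  ext x
  rw [toOp_tensorToTraceClass, ← hA]
  have h1 : HasSum (fun i => ProjTensor.toOperator (f i) x) (ProjTensor.toOperator (∑' i, f i) x) :=
    (hfs.hasSum.mapL ProjTensor.toOperator).mapL (ContinuousLinearMap.apply ℂ H x)
  have h2 : HasSum (fun i => (W * R) (⟪e i, R x⟫_ℂ • e i)) ((W * R) (R x)) := by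
    have := e.hasSum_repr (R x)
    simp only [e.repr_apply_apply] at this
    exact this.mapL (W * R)
  have h3 : ∀ i, ProjTensor.toOperator (f i) x = (W * R) (⟪e i, R x⟫_ℂ • e i) := fun i => by
    rw [ProjTensor.toOperator_tmul, ContinuousLinearMap.smulRight_apply, innerSL_apply_apply,
      map_smul, ← ContinuousLinearMap.adjoint_inner_right, ← ContinuousLinearMap.star_eq_adjoint,
      hRs, mul_apply_eq_comp]
  simp only [h3] at h1
  rw [h1.unique h2, ← mul_apply_eq_comp, mul_assoc, hRR, hWA]

variable (H) in
/-- The isometric isomorphism `H* ⊗^γ H ≅ S₁(H)`. -/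
def tensorEquivTraceClass : ProjTensor (StrongDual ℂ H) H ≃ₗᵢ[ℂ] TraceClass H where
  toLinearEquiv := .ofBijective (tensorToTraceClass H).toLinearMap
    ⟨tensorToTraceClass_injective, fun T => by
      obtain ⟨u, -, hu⟩ := exists_tensor_of_traceClass T
      exact ⟨u, hu⟩⟩
  norm_map' u := by
    refine le_antisymm (norm_tensorToTraceClass_le u) ?_
    obtain ⟨v, hv, hvu⟩ := exists_tensor_of_traceClass (tensorToTraceClass H u)
    rw [tensorToTraceClass_injective hvu] at hv
    exact hv

theorem tensorEquivTraceClass_tmul (φ : StrongDual ℂ H) (y : H) :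
    tensorEquivTraceClass H (ProjTensor.tmul φ y) = rankOneTraceClass φ y :=
  tensorToTraceClass_tmul φ y

end TraceClassTensor

/-! ### The trace pairing -/

section TracePairing

variable {H : Type*} [NormedAddCommGroup H] [InnerProductSpace ℂ H]

theorem norm_pairing_apply_le (B : H →L[ℂ] H) (u : ProjTensor (StrongDual ℂ H) H) :
    ‖ProjTensor.pairing B u‖ ≤ ‖B‖ * ‖u‖ := by
  refine ProjTensor.norm_apply_le_of_tmul (norm_nonneg B) _ (fun φ y => ?_) u
  rw [ProjTensor.pairing_tmul]
  calc ‖φ (B y)‖ ≤ ‖φ‖ * (‖B‖ * ‖y‖) := φ.le_opNorm_of_le (B.le_opNorm y)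
    _ = ‖B‖ * (‖φ‖ * ‖y‖) := by ring

theorem norm_pairing (B : H →L[ℂ] H) :
    ‖(ProjTensor.pairing B : StrongDual ℂ (ProjTensor (StrongDual ℂ H) H))‖ = ‖B‖ := by
  refine le_antisymm (ContinuousLinearMap.opNorm_le_bound _ (norm_nonneg _)
    (norm_pairing_apply_le B)) (ContinuousLinearMap.opNorm_le_bound _ (norm_nonneg _) fun y => ?_)
  have h := (ProjTensor.pairing B).le_opNorm_of_le
    (ProjTensor.norm_tmul_le (innerSL ℂ (B y)) y)
  rw [ProjTensor.pairing_tmul, innerSL_apply_apply, innerSL_apply_norm,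
    inner_self_eq_norm_sq_to_K, norm_pow, RCLike.norm_ofReal, abs_norm, sq] at h
  rcases (norm_nonneg (B y)).eq_or_lt with h0 | h0
  · rw [← h0]; positivity
  · exact le_of_mul_le_mul_left (by linarith) h0

variable [CompleteSpace H]

/-- Every bounded functional on `H* ⊗^γ H` is `φ ⊗ y ↦ φ (B y)` for a bounded operator `B`, since
`H` is reflexive. -/
theorem exists_pairing_eq (ω : StrongDual ℂ (ProjTensor (StrongDual ℂ H) H)) :
    ∃ B : H →L[ℂ] H, ProjTensor.pairing B = ω := by
  let J : StrongDual ℂ H →L[ℂ] H →L[ℂ] ℂ :=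
    ContinuousLinearMap.compL ℂ _ _ _ ω ∘L ProjTensor.tmulL
  refine ⟨(InnerProductSpace.continuousLinearMapOfBilin (J.comp (innerSL ℂ))).adjoint,
    ProjTensor.clm_ext fun φ y => ?_⟩
  obtain ⟨x, rfl⟩ := (InnerProductSpace.toDual ℂ H).surjective φ
  rw [ProjTensor.pairing_tmul, InnerProductSpace.toDual_apply_apply,
    ContinuousLinearMap.adjoint_inner_right,
    InnerProductSpace.continuousLinearMapOfBilin_apply]
  rfl

theorem hasSum_pairing {ι : Type*} (e : HilbertBasis ι ℂ H) (B : H →L[ℂ] H)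
    (u : ProjTensor (StrongDual ℂ H) H) :
    HasSum (fun i => ⟪e i, B (ProjTensor.toOperator u (e i))⟫_ℂ) (ProjTensor.pairing B u) := by
  -- The partial sums are the functional `φ ⊗ y ↦ φ y` at truncations of the second factor.
  let id' := ContinuousLinearMap.id ℂ (StrongDual ℂ H)
  have h1 : ProjTensor.pairing B = ProjTensor.pairing (.id ℂ H) ∘L ProjTensor.map id' B :=
    ProjTensor.clm_ext fun φ y => by simp [id']
  have h2 : ∀ s : Finset ι, ∑ i ∈ s, (innerSL ℂ (e i)) ∘L B ∘L
      (ContinuousLinearMap.apply ℂ H (e i)) ∘L ProjTensor.toOperator =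
      ProjTensor.pairing (.id ℂ H) ∘L ProjTensor.map id' (partialSum e s) ∘L
        ProjTensor.map id' B := fun s => ProjTensor.clm_ext fun φ y => by
    simp [id', partialSum_apply, mul_comm]
  have h3 := ((ProjTensor.pairing (.id ℂ H)).continuous.tendsto _).comp
    (tendsto_map_partialSum e (ProjTensor.map id' B u))
  rw [h1]
  refine h3.congr fun s => ?_
  have := DFunLike.congr_fun (h2 s) u
  rw [sum_apply] at this
  exact this.symm

variable (H) in
/-- The isometric isomorphism `B(H) ≅ S₁(H)*` given by the trace pairing. -/
def tracePairing : (H →L[ℂ] H) ≃ₗᵢ[ℂ] StrongDual ℂ (TraceClass H) :=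
  .ofSurjective
    { toFun := fun B => ProjTensor.pairing B ∘L
        ((tensorEquivTraceClass H).symm : TraceClass H →L[ℂ] ProjTensor (StrongDual ℂ H) H)
      map_add' := fun B C => by
        rw [← ContinuousLinearMap.add_comp]
        congr 1
        exact ProjTensor.clm_ext fun φ y => by simp
      map_smul' := fun c B => by
        rw [RingHom.id_apply, ← ContinuousLinearMap.smul_comp]
        congr 1
        exact ProjTensor.clm_ext fun φ y => by simp
      norm_map' := fun B =>
        (ContinuousLinearMap.opNorm_comp_linearIsometryEquiv _ _).trans (norm_pairing B) }
    fun ω => by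
      obtain ⟨B, hB⟩ := exists_pairing_eq
        (ω ∘L (tensorEquivTraceClass H : ProjTensor (StrongDual ℂ H) H →L[ℂ] TraceClass H))
      refine ⟨B, ?_⟩
      ext T
      change ProjTensor.pairing B ((tensorEquivTraceClass H).symm T) = ω T
      rw [hB]
      exact congrArg ω ((tensorEquivTraceClass H).apply_symm_apply T)

theorem hasSum_tracePairing {ι : Type*} (e : HilbertBasis ι ℂ H) (B : H →L[ℂ] H)
    (T : TraceClass H) :
    HasSum (fun i => ⟪e i, B (TraceClass.toOp T (e i))⟫_ℂ) (tracePairing H B T) := by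
  have h := hasSum_pairing e B ((tensorEquivTraceClass H).symm T)
  rw [← toOp_tensorToTraceClass] at h
  have h' : tensorToTraceClass H ((tensorEquivTraceClass H).symm T) = T :=
    (tensorEquivTraceClass H).apply_symm_apply T
  rw [h'] at h
  exact h

end TracePairing

/-! ### Hilbert–Schmidt operators: matrix units and complex conjugation -/

section HilbertBasisNat

variable {H : Type*} [NormedAddCommGroup H] [InnerProductSpace ℂ H] [CompleteSpace H]

/-- A Hilbert basis, indexed by a type equivalent to the given index type. -/
theorem exists_hilbertBasis_of_equiv {ι κ : Type*} (b : HilbertBasis ι ℂ H) (f : κ ≃ ι) :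
    ∃ c : HilbertBasis κ ℂ H, ∀ k, c k = b (f k) := by
  refine ⟨.mk (v := b ∘ f) (b.orthonormal.comp f f.injective) ?_, fun k => ?_⟩
  · rw [f.surjective.range_comp, b.dense_span]
  · rw [HilbertBasis.coe_mk]; rfl

theorem nonempty_hilbertBasis_nat [TopologicalSpace.SeparableSpace H]
    (hH : ¬ FiniteDimensional ℂ H) : Nonempty (HilbertBasis ℕ ℂ H) := by
  obtain ⟨w, b, hb⟩ := exists_hilbertBasis ℂ H
  -- The balls of radius `1 / 2` around the basis vectors are disjoint.
  have hc : Countable w := by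
    refine Pairwise.countable_of_isOpen_disjoint (s := fun i => Metric.ball (b i) (1 / 2))
      (fun i j hij => Metric.ball_disjoint_ball ?_) (fun i => Metric.isOpen_ball)
      fun i => ⟨b i, Metric.mem_ball_self (by norm_num)⟩
    have h := norm_sub_sq (𝕜 := ℂ) (b i) (b j)
    rw [b.orthonormal.2 hij, b.orthonormal.1, b.orthonormal.1, map_zero] at h
    rw [dist_eq_norm]
    nlinarith [norm_nonneg (b i - b j)]
  have hi : Infinite w := by
    by_contra hf
    rw [not_infinite_iff_finite] at hf
    have := Fintype.ofFinite w
    exact hH (Module.Basis.finiteDimensional_of_finite b.toOrthonormalBasis.toBasis)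
  obtain ⟨f⟩ := nonempty_equiv_of_countable (α := ℕ) (β := w)
  obtain ⟨c, -⟩ := exists_hilbertBasis_of_equiv b f
  exact ⟨c⟩

end HilbertBasisNat

section MatrixUnits

variable {H : Type*} [NormedAddCommGroup H] [InnerProductSpace ℂ H] [CompleteSpace H]

theorem hsSum_smulRight {ι : Type*} (e : HilbertBasis ι ℂ H) (x y : H) :
    hsSum e ((innerSL ℂ y).smulRight x) = ‖x‖ₑ ^ 2 * ‖y‖ₑ ^ 2 := by
  rw [hsSum, ← tsum_enorm_inner_sq e y, ← ENNReal.tsum_mul_left]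
  refine tsum_congr fun i => ?_
  rw [ContinuousLinearMap.smulRight_apply, innerSL_apply_apply, enorm_smul, mul_pow, mul_comm,
    ← inner_conj_symm, RCLike.enorm_conj]

namespace HilbertSchmidt

theorem norm_sq_eq_toReal_hsSum {ι : Type*} (e : HilbertBasis ι ℂ H) (T : HilbertSchmidt H) :
    ‖T‖ ^ 2 = (hsSum e (toOp T)).toReal := by
  rw [norm_def, ← ENNReal.toReal_pow, schattenENorm_two_sq, hsSum_eq (stdBasis H) e]

theorem schattenENorm_two_ne_top_of_hsSum {ι : Type*} (e : HilbertBasis ι ℂ H) {T : H →L[ℂ] H}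
    (h : hsSum e T ≠ ∞) : schattenENorm 2 T ≠ ∞ := by
  rw [schattenENorm_two_eq, hsSum_eq (stdBasis H) e]
  exact ENNReal.rpow_ne_top_of_nonneg (by norm_num) h

/-- The rank one operator `z ↦ ⟪y, z⟫ x`, as a Hilbert–Schmidt operator. -/
def rankOne (x y : H) : HilbertSchmidt H :=
  .mk ((innerSL ℂ y).smulRight x) <| schattenENorm_two_ne_top_of_hsSum (stdBasis H) <| by
    rw [hsSum_smulRight]; finiteness

theorem toOp_rankOne_apply (x y z : H) : toOp (rankOne x y) z = ⟪y, z⟫_ℂ • x := rfl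

theorem norm_rankOne (x y : H) : ‖rankOne x y‖ = ‖x‖ * ‖y‖ := by
  rw [← sq_eq_sq₀ (norm_nonneg _) (by positivity), norm_sq_eq_toReal_hsSum (stdBasis H), rankOne,
    toOp_mk, hsSum_smulRight, mul_pow]
  simp

theorem mul_rankOne (T : HilbertSchmidt H) (x y : H) :
    T * rankOne x y = rankOne (toOp T x) y := by
  ext1; ext z
  simp [toOp_rankOne_apply]

theorem inner_rankOne_left (x y : H) (T : HilbertSchmidt H) :
    ⟪rankOne x y, T⟫_ℂ = ⟪x, toOp T y⟫_ℂ := by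
  rw [← inner_columns, lp.inner_eq_tsum, ← ContinuousLinearMap.adjoint_inner_left,
    ← (stdBasis H).tsum_inner_mul_inner]
  refine tsum_congr fun i => ?_
  rw [columns_apply, columns_apply, toOp_rankOne_apply, inner_smul_left, inner_conj_symm,
    ContinuousLinearMap.adjoint_inner_left, mul_comm]

theorem orthonormal_rankOne {ι : Type*} (e : HilbertBasis ι ℂ H) :
    Orthonormal ℂ fun p : ι × ι => rankOne (e p.1) (e p.2) := by
  classical
  have he := orthonormal_iff_ite.1 e.orthonormal
  rw [orthonormal_iff_ite]
  rintro ⟨i, j⟩ ⟨k, l⟩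
  rw [inner_rankOne_left, toOp_rankOne_apply, inner_smul_right, he, he]
  simp only [Prod.mk.injEq, ite_and]
  split_ifs <;> simp_all

/-- The matrix units `⟪eⱼ, ·⟫ eᵢ` of an orthonormal basis form an orthonormal basis of `S₂(H)`. -/
def matrixUnits {ι : Type*} (e : HilbertBasis ι ℂ H) : HilbertBasis (ι × ι) ℂ (HilbertSchmidt H) :=
  .mkOfOrthogonalEqBot (orthonormal_rankOne e) <| by
    refine (Submodule.eq_bot_iff _).2 fun T hT => ?_
    rw [Submodule.mem_orthogonal] at hT
    have h : ∀ i j, ⟪e i, toOp T (e j)⟫_ℂ = 0 := fun i j => by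
      rw [← inner_rankOne_left]
      exact hT _ (Submodule.subset_span ⟨(i, j), rfl⟩)
    ext1
    refine ContinuousLinearMap.ext_on
      (Submodule.dense_iff_topologicalClosure_eq_top.2 e.dense_span) ?_
    rintro _ ⟨j, rfl⟩
    refine e.repr.injective ?_
    ext i
    rw [e.repr_apply_apply, h, map_zero, zero_apply, map_zero]
    rfl

/-- A separable infinite-dimensional Hilbert space is unitarily equivalent to its space of
Hilbert–Schmidt operators. -/
theorem nonempty_linearIsometryEquiv (e : HilbertBasis ℕ ℂ H) :
    Nonempty (H ≃ₗᵢ[ℂ] HilbertSchmidt H) := by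
  obtain ⟨c, -⟩ := exists_hilbertBasis_of_equiv (matrixUnits e) Nat.pairEquiv.symm
  exact ⟨e.repr.trans c.repr.symm⟩

end HilbertSchmidt

end MatrixUnits

section Conjugation

variable {H : Type*} [NormedAddCommGroup H] [InnerProductSpace ℂ H]

/-- The complex conjugation of `H` that fixes the vectors of an orthonormal basis. -/
def conjugation {ι : Type*} (e : HilbertBasis ι ℂ H) : H ≃ₗᵢ⋆[ℂ] H :=
  (e.repr.trans (starₗᵢ ℂ)).trans e.repr.symm

theorem conjugation_conjugation {ι : Type*} (e : HilbertBasis ι ℂ H) (x : H) :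
    conjugation e (conjugation e x) = x := by
  simp [conjugation]

theorem conjugation_basis {ι : Type*} (e : HilbertBasis ι ℂ H) (i : ι) :
    conjugation e (e i) = e i := by
  classical
  have : star (e.repr (e i)) = e.repr (e i) := by
    rw [e.repr_self]
    ext j
    rcases eq_or_ne j i with rfl | h
    · simp
    · simp [h]
  simp [conjugation, this]

/-- The operator `J T J`, where `J` is the conjugation fixing the basis `e`. -/
def conjOp {ι : Type*} (e : HilbertBasis ι ℂ H) (T : H →L[ℂ] H) : H →L[ℂ] H :=
  ((conjugation e : H →L⋆[ℂ] H).comp T).comp (conjugation e : H →L⋆[ℂ] H)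

theorem conjOp_apply {ι : Type*} (e : HilbertBasis ι ℂ H) (T : H →L[ℂ] H) (x : H) :
    conjOp e T x = conjugation e (T (conjugation e x)) := rfl

theorem hsSum_conjOp {ι : Type*} (e : HilbertBasis ι ℂ H) (T : H →L[ℂ] H) :
    hsSum e (conjOp e T) = hsSum e T := by
  refine tsum_congr fun i => ?_
  rw [conjOp_apply, conjugation_basis, LinearIsometryEquiv.enorm_map]

variable [CompleteSpace H]

namespace HilbertSchmidt

/-- The conjugate linear, isometric and multiplicative involution `T ↦ J T J` of `S₂(H)`. -/
def conj {ι : Type*} (e : HilbertBasis ι ℂ H) : HilbertSchmidt H ≃ₗᵢ⋆[ℂ] HilbertSchmidt H :=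
  have hn : ∀ T : HilbertSchmidt H, hsSum e (conjOp e (toOp T)) ≠ ∞ := fun T => by
    rw [hsSum_conjOp, hsSum_eq e (stdBasis H), ← schattenENorm_two_sq]
    finiteness [T.schattenENorm_ne_top]
  let f : HilbertSchmidt H → HilbertSchmidt H := fun T =>
    .mk (conjOp e (toOp T)) (schattenENorm_two_ne_top_of_hsSum e (hn T))
  have hf : ∀ T, f (f T) = T := fun T => by
    ext1; ext x
    simp [f, conjOp_apply, conjugation_conjugation]
  { toFun := f
    map_add' := fun S T => by ext1; ext x; simp [f, conjOp_apply]
    map_smul' := fun c T => by ext1; ext x; simp [f, conjOp_apply, map_smulₛₗ]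
    invFun := f
    left_inv := hf
    right_inv := hf
    norm_map' := fun T => by
      rw [← sq_eq_sq₀ (norm_nonneg _) (norm_nonneg _), norm_sq_eq_toReal_hsSum e,
        norm_sq_eq_toReal_hsSum e, ← hsSum_conjOp e (toOp T)]
      rfl }

theorem toOp_conj_apply {ι : Type*} (e : HilbertBasis ι ℂ H) (T : HilbertSchmidt H) (x : H) :
    toOp (conj e T) x = conjugation e (toOp T (conjugation e x)) := rfl

theorem conj_mul {ι : Type*} (e : HilbertBasis ι ℂ H) (S T : HilbertSchmidt H) :
    conj e (S * T) = conj e S * conj e T := by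
  ext1; ext x
  simp [toOp_conj_apply, conjugation_conjugation]

/-- The multiplicative isometric isomorphism `S₂(H)* ≅ S₂(H)`: the conjugate linear Riesz
identification followed by the conjugate linear map `T ↦ J T J`. -/
def dualEquiv {ι : Type*} (e : HilbertBasis ι ℂ H) :
    StrongDual ℂ (HilbertSchmidt H) ≃ₗᵢ[ℂ] HilbertSchmidt H :=
  (InnerProductSpace.toDual ℂ (HilbertSchmidt H)).symm.trans (conj e)

theorem dualEquiv_mul {ι : Type*} (e : HilbertBasis ι ℂ H)
    (φ ψ : StrongDual ℂ (HilbertSchmidt H)) :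
    dualEquiv e ((hilbertSchmidtDualAlgebra H).mul φ ψ) =
      (hilbertSchmidtAlgebra H).mul (dualEquiv e φ) (dualEquiv e ψ) := by
  obtain ⟨S, rfl⟩ := (InnerProductSpace.toDual ℂ (HilbertSchmidt H)).surjective φ
  obtain ⟨T, rfl⟩ := (InnerProductSpace.toDual ℂ (HilbertSchmidt H)).surjective ψ
  rw [hilbertSchmidtDualAlgebra_mul_toDual, hilbertSchmidtAlgebra_mul]
  simp [dualEquiv, conj_mul]

end HilbertSchmidt

end Conjugation

/-! ### Arens products along sequences -/

section ArensCriteria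

open Filter Topology

variable {X : Type*} [NormedAddCommGroup X] [NormedSpace ℂ X]

/-- A bounded sequence converges along every ultrafilter in the weak* topology of the bidual
(Banach–Alaoglu). -/
theorem exists_bidual_tendsto (U : Ultrafilter ℕ) {a : ℕ → X} {C : ℝ} (ha : ∀ n, ‖a n‖ ≤ C) :
    ∃ f : StrongDual ℂ (StrongDual ℂ X), ∀ ω : StrongDual ℂ X,
      Tendsto (fun n => ω (a n)) U (𝓝 (f ω)) := by
  have hK := WeakDual.isCompact_closedBall (0 : StrongDual ℂ (StrongDual ℂ X)) C
  let v : ℕ → WeakDual ℂ (StrongDual ℂ X) := fun n =>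
    StrongDual.toWeakDual (NormedSpace.inclusionInDoubleDual ℂ X (a n))
  have hv : ∀ n, v n ∈ WeakDual.toStrongDual ⁻¹'
      Metric.closedBall (0 : StrongDual ℂ (StrongDual ℂ X)) C := fun n =>
    (dist_zero_right (NormedSpace.inclusionInDoubleDual ℂ X (a n))).trans_le
      ((NormedSpace.double_dual_bound ℂ X (a n)).trans (ha n))
  obtain ⟨f, -, hf⟩ := hK.ultrafilter_le_nhds (U.map v)
    (le_principal_iff.2 (Filter.mem_map.2 (Filter.univ_mem' hv)))
  refine ⟨WeakDual.toStrongDual f, fun ω => ?_⟩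
  exact ((WeakDual.eval_continuous ω).tendsto f).comp hf

namespace BanachAlgebraStructure

variable [CompleteSpace X]

/-- If the iterated limits of `ω (aᵢ bⱼ)` differ, then cluster points of the two sequences have
different Arens products. -/
theorem not_isArensRegular_of_seq (M : BanachAlgebraStructure X) {a b : ℕ → X} {C : ℝ}
    (ha : ∀ n, ‖a n‖ ≤ C) (hb : ∀ n, ‖b n‖ ≤ C) (ω : StrongDual ℂ X)
    (hω : ∀ i j, ω (M.mul (a i) (b j)) = if i ≤ j then 1 else 0) : ¬ M.IsArensRegular := by
  intro h
  have hU : ((hyperfilter ℕ : Ultrafilter ℕ) : Filter ℕ) ≤ atTop := Nat.hyperfilter_le_atTop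
  obtain ⟨f, hf⟩ := exists_bidual_tendsto (hyperfilter ℕ) ha
  obtain ⟨g, hg⟩ := exists_bidual_tendsto (hyperfilter ℕ) hb
  have h1 : ∀ i, M.bidualLeft g ω (a i) = 1 := fun i => by
    refine tendsto_nhds_unique (hg (M.dualRight ω (a i))) (Tendsto.mono_left ?_ hU)
    refine tendsto_const_nhds.congr' ((eventually_ge_atTop i).mono fun j hj => ?_)
    exact ((hω i j).trans (if_pos hj)).symm
  have h2 : ∀ j, M.bidualRight f ω (b j) = 0 := fun j => by
    refine tendsto_nhds_unique (hf (M.dualLeft ω (b j))) (Tendsto.mono_left ?_ hU)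
    refine tendsto_const_nhds.congr' ((eventually_gt_atTop j).mono fun i hi => ?_)
    exact ((hω i j).trans (if_neg hi.not_ge)).symm
  have h3 : M.arensBox f g ω = 1 := by
    have := hf (M.bidualLeft g ω)
    simp only [h1] at this
    exact tendsto_nhds_unique this tendsto_const_nhds
  have h4 : M.arensDiamond f g ω = 0 := by
    have := hg (M.bidualRight f ω)
    simp only [h2] at this
    exact tendsto_nhds_unique this tendsto_const_nhds
  rw [h f g, h4] at h3
  exact zero_ne_one h3

/-- Let `(aₙ)` be a bounded sequence such that `b ↦ (b aₙ)` maps the algebra boundedly into the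
absolutely summable sequences. For every functional `ω` the functionals `b ↦ ω (b aₙ)` then have
bounded signed sums, so they tend weakly to zero, and every cluster point `φ` of `(aₙ)` satisfies
`ψ □ φ = 0 = ψ ⋄ φ` for all `ψ`. The remaining hypotheses keep `φ` out of the algebra. -/
theorem not_isRightStronglyArensIrregular_of_seq (M : BanachAlgebraStructure X) {a : ℕ → X}
    {C : ℝ} (ha : ∀ n, ‖a n‖ ≤ C)
    (hsum : ∀ (s : Finset ℕ) (b : X), ∑ n ∈ s, ‖M.mul b (a n)‖ ≤ ‖b‖)
    (hne : ∃ ω : StrongDual ℂ X, ∀ n, ω (a n) = 1)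
    (hsep : ∀ x : X, x ≠ 0 → ∃ ω : StrongDual ℂ X, ω x ≠ 0 ∧
      Tendsto (fun n => ω (a n)) atTop (𝓝 0)) :
    ¬ M.IsRightStronglyArensIrregular := by
  intro h
  have hU : ((hyperfilter ℕ : Ultrafilter ℕ) : Filter ℕ) ≤ atTop := Nat.hyperfilter_le_atTop
  obtain ⟨φ, hφ⟩ := exists_bidual_tendsto (hyperfilter ℕ) ha
  have h1 : ∀ ω, M.bidualLeft φ ω = 0 := fun ω => by
    ext b
    refine tendsto_nhds_unique (hφ (M.dualRight ω b)) (Tendsto.mono_left ?_ hU)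
    have hs : Summable fun n => ‖M.mul b (a n)‖ :=
      summable_of_sum_le (fun n => norm_nonneg _) fun s => hsum s b
    exact ((ω.continuous.tendsto' 0 0 (map_zero ω)).comp
      (tendsto_zero_iff_norm_tendsto_zero.2 hs.tendsto_atTop_zero))
  have h2 : ∀ ψ ω, φ (M.bidualRight ψ ω) = 0 := fun ψ ω => by
    refine tendsto_nhds_unique (hφ (M.bidualRight ψ ω)) (Tendsto.mono_left ?_ hU)
    have hs : Summable fun n => ‖ψ (M.dualLeft ω (a n))‖ := by
      refine summable_of_sum_le (c := ‖ψ‖ * ‖ω‖) (fun n => norm_nonneg _) fun s => ?_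
      -- Unimodular factors `c n` turn the sum of absolute values into a value of `ψ`.
      choose c hc hcψ using fun n => RCLike.exists_norm_eq_mul_self (ψ (M.dualLeft ω (a n)))
      have hF : ‖∑ n ∈ s, c n • M.dualLeft ω (a n)‖ ≤ ‖ω‖ := by
        refine ContinuousLinearMap.opNorm_le_bound _ (norm_nonneg ω) fun b => ?_
        rw [sum_apply]
        calc ‖∑ n ∈ s, c n • ω (M.mul b (a n))‖ ≤ ∑ n ∈ s, ‖ω‖ * ‖M.mul b (a n)‖ := by
              refine norm_sum_le_of_le s fun n _ => ?_
              rw [norm_smul, hc, one_mul]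
              exact ω.le_opNorm _
          _ ≤ ‖ω‖ * ‖b‖ := by
              rw [← Finset.mul_sum]
              exact mul_le_mul_of_nonneg_left (hsum s b) (norm_nonneg ω)
      have hψ : ((∑ n ∈ s, ‖ψ (M.dualLeft ω (a n))‖ : ℝ) : ℂ) =
          ψ (∑ n ∈ s, c n • M.dualLeft ω (a n)) := by
        rw [map_sum, Complex.ofReal_sum]
        exact Finset.sum_congr rfl fun n _ => by rw [map_smul, smul_eq_mul]; exact hcψ n
      have hn := ψ.le_opNorm_of_le hF
      rw [← hψ, Complex.norm_real] at hn
      exact (le_abs_self _).trans hn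
    exact tendsto_zero_iff_norm_tendsto_zero.2 hs.tendsto_atTop_zero
  have h3 : φ ∈ M.rightTopologicalCenter := fun ψ => by
    ext ω
    change ψ (M.bidualLeft φ ω) = φ (M.bidualRight ψ ω)
    rw [h1, h2, map_zero]
  rw [h] at h3
  obtain ⟨x, rfl⟩ := h3
  obtain ⟨ω₀, hω₀⟩ := hne
  have hx : x ≠ 0 := by
    rintro rfl
    have := hφ ω₀
    simp only [hω₀] at this
    have := tendsto_nhds_unique this tendsto_const_nhds
    simp at this
  obtain ⟨ω, hωx, hω⟩ := hsep x hx
  exact hωx (tendsto_nhds_unique (hφ ω) (hω.mono_left hU))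

end BanachAlgebraStructure

end ArensCriteria

/-! ### The two Arens counterexamples in `S₂(H)* ⊗^γ S₂(H)` -/

section Counterexamples

open Filter Topology

variable {H : Type*} [NormedAddCommGroup H] [InnerProductSpace ℂ H] [CompleteSpace H]

variable (H) in
/-- The Banach algebra `S₂(H)* ⊗^γ S₂(H)`. -/
abbrev dualTensorAlgebra : BanachAlgebraStructure
    (ProjTensor (StrongDual ℂ (HilbertSchmidt H)) (HilbertSchmidt H)) :=
  (hilbertSchmidtDualAlgebra H).projTensor (hilbertSchmidtAlgebra H)

/-- The tensor `T* ⊗ T` in `S₂(H)* ⊗^γ S₂(H)`, where `T*` is the functional represented by `T`. -/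
def diagTensor (T : HilbertSchmidt H) :
    ProjTensor (StrongDual ℂ (HilbertSchmidt H)) (HilbertSchmidt H) :=
  .tmul (InnerProductSpace.toDual ℂ _ T) T

theorem norm_diagTensor_le (T : HilbertSchmidt H) : ‖diagTensor T‖ ≤ ‖T‖ * ‖T‖ := by
  refine (ProjTensor.norm_tmul_le _ _).trans ?_
  rw [LinearIsometryEquiv.norm_map]

theorem dualTensorAlgebra_mul_diagTensor (R S T : HilbertSchmidt H) :
    (dualTensorAlgebra H).mul (.tmul (InnerProductSpace.toDual ℂ _ R) S) (diagTensor T) =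
      .tmul (InnerProductSpace.toDual ℂ _ (R * T)) (S * T) := by
  rw [diagTensor, BanachAlgebraStructure.projTensor_mul_tmul,
    hilbertSchmidtDualAlgebra_mul_toDual, hilbertSchmidtAlgebra_mul]

theorem pairing_diagTensor (D : HilbertSchmidt H →L[ℂ] HilbertSchmidt H) (T : HilbertSchmidt H) :
    ProjTensor.pairing D (diagTensor T) = ⟪T, D T⟫_ℂ := by
  rw [diagTensor, ProjTensor.pairing_tmul, InnerProductSpace.toDual_apply_apply]

theorem norm_diagTensor_rankOne_le (e : HilbertBasis ℕ ℂ H) (i j : ℕ) :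
    ‖diagTensor (HilbertSchmidt.rankOne (e i) (e j))‖ ≤ 1 := by
  refine (norm_diagTensor_le _).trans ?_
  rw [HilbertSchmidt.norm_rankOne, e.orthonormal.1, e.orthonormal.1]
  norm_num

theorem rankOne_mul_rankOne (e : HilbertBasis ℕ ℂ H) (i j k : ℕ) :
    HilbertSchmidt.rankOne (e i) (e j) * HilbertSchmidt.rankOne (e j) (e k) =
      HilbertSchmidt.rankOne (e i) (e k) := by
  rw [HilbertSchmidt.mul_rankOne, HilbertSchmidt.toOp_rankOne_apply,
    inner_self_eq_norm_sq_to_K, e.orthonormal.1]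
  simp

/-- The orthogonal projection of `S₂(H)` onto the upper triangular operators. -/
def upperProj (e : HilbertBasis ℕ ℂ H) : HilbertSchmidt H →L[ℂ] HilbertSchmidt H :=
  (Submodule.span ℂ ((fun p : ℕ × ℕ => HilbertSchmidt.rankOne (e p.1) (e p.2)) ''
    {p | p.1 ≤ p.2})).topologicalClosure.starProjection

theorem inner_upperProj (e : HilbertBasis ℕ ℂ H) (i j : ℕ) :
    ⟪HilbertSchmidt.rankOne (e i) (e j), upperProj e (HilbertSchmidt.rankOne (e i) (e j))⟫_ℂ =
      if i ≤ j then 1 else 0 := by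
  have ho := HilbertSchmidt.orthonormal_rankOne e
  have h1 : ‖HilbertSchmidt.rankOne (e i) (e j)‖ = 1 := ho.1 (i, j)
  split_ifs with h
  · rw [upperProj, Submodule.starProjection_eq_self_iff.2, inner_self_eq_norm_sq_to_K, h1]
    · simp
    · exact Submodule.le_topologicalClosure _ (Submodule.subset_span ⟨(i, j), h, rfl⟩)
  · rw [upperProj, (Submodule.starProjection_apply_eq_zero_iff _).2, inner_zero_right]
    rw [Submodule.orthogonal_closure, Submodule.mem_orthogonal]
    intro S hS
    induction hS using Submodule.span_induction with
    | mem S hS =>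
      obtain ⟨p, hp, rfl⟩ := hS
      exact ho.2 (i := p) (j := (i, j)) (by rintro rfl; exact h hp)
    | zero => exact inner_zero_left _
    | add S T _ _ hS hT => rw [inner_add_left, hS, hT, add_zero]
    | smul c S _ hS => rw [inner_smul_left, hS, mul_zero]

/-- With `eᵢⱼ` the matrix units, `(eᵢ₀* ⊗ eᵢ₀) (e₀ⱼ* ⊗ e₀ⱼ) = eᵢⱼ* ⊗ eᵢⱼ`, and triangular
truncation in the second factor gives a bounded functional with the value `1` there if `i ≤ j` and
`0` otherwise. -/
theorem not_isArensRegular_induced (e : HilbertBasis ℕ ℂ H) {X : Type*} [NormedAddCommGroup X]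
    [NormedSpace ℂ X] [CompleteSpace X]
    (Φ : X ≃ₗᵢ[ℂ] ProjTensor (StrongDual ℂ (HilbertSchmidt H)) (HilbertSchmidt H)) :
    ¬ ((dualTensorAlgebra H).induced Φ).IsArensRegular := by
  refine BanachAlgebraStructure.not_isArensRegular_of_seq (C := 1) _
    (a := fun i => Φ.symm (diagTensor (HilbertSchmidt.rankOne (e i) (e 0))))
    (b := fun j => Φ.symm (diagTensor (HilbertSchmidt.rankOne (e 0) (e j))))
    (fun i => ?_) (fun j => ?_) (ProjTensor.pairing (upperProj e) ∘L (Φ : X →L[ℂ] _))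
    fun i j => ?_
  · rw [LinearIsometryEquiv.norm_map]
    exact norm_diagTensor_rankOne_le e i 0
  · rw [LinearIsometryEquiv.norm_map]
    exact norm_diagTensor_rankOne_le e 0 j
  · rw [BanachAlgebraStructure.induced_mul, Φ.apply_symm_apply, Φ.apply_symm_apply, diagTensor,
      dualTensorAlgebra_mul_diagTensor, rankOne_mul_rankOne, ← diagTensor]
    refine (congrArg (ProjTensor.pairing (upperProj e)) (Φ.apply_symm_apply _)).trans ?_
    rw [pairing_diagTensor, inner_upperProj]

theorem sum_norm_sq_apply_le (e : HilbertBasis ℕ ℂ H) (s : Finset ℕ) (T : HilbertSchmidt H) :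
    ∑ n ∈ s, ‖HilbertSchmidt.toOp T (e n)‖ ^ 2 ≤ ‖T‖ ^ 2 := by
  rw [HilbertSchmidt.norm_sq_eq_toReal_hsSum e]
  have hT : hsSum e (HilbertSchmidt.toOp T) ≠ ∞ := by
    rw [hsSum_eq e (stdBasis H), ← schattenENorm_two_sq]
    finiteness [T.schattenENorm_ne_top]
  have h := ENNReal.toReal_mono hT
    (ENNReal.sum_le_tsum (f := fun i => ‖HilbertSchmidt.toOp T (e i)‖ₑ ^ 2) s)
  rw [ENNReal.toReal_sum (fun i _ => by finiteness)] at h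
  simpa using h

/-- The multiplications `b ↦ b (eₙ₀* ⊗ eₙ₀)` see the `n`-th columns of the two factors of `b`, so
their norms are summable by the Cauchy–Schwarz inequality. -/
theorem sum_norm_mul_diagTensor_le (e : HilbertBasis ℕ ℂ H) (s : Finset ℕ)
    (b : ProjTensor (StrongDual ℂ (HilbertSchmidt H)) (HilbertSchmidt H)) :
    ∑ n ∈ s, ‖(dualTensorAlgebra H).mul b
      (diagTensor (HilbertSchmidt.rankOne (e n) (e 0)))‖ ≤ ‖b‖ := by
  refine ProjTensor.sum_norm_apply_le_of_tmul s (fun n => (dualTensorAlgebra H).mul.flip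
    (diagTensor (HilbertSchmidt.rankOne (e n) (e 0)))) (fun φ T => ?_) b
  obtain ⟨S, rfl⟩ := (InnerProductSpace.toDual ℂ (HilbertSchmidt H)).surjective φ
  rw [LinearIsometryEquiv.norm_map]
  have h1 : ∀ n ∈ s, ‖(dualTensorAlgebra H).mul
      (.tmul (InnerProductSpace.toDual ℂ (HilbertSchmidt H) S) T)
        (diagTensor (HilbertSchmidt.rankOne (e n) (e 0)))‖ ≤
      ‖HilbertSchmidt.toOp S (e n)‖ * ‖HilbertSchmidt.toOp T (e n)‖ := fun n _ => by
    rw [dualTensorAlgebra_mul_diagTensor]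
    refine (ProjTensor.norm_tmul_le _ _).trans_eq ?_
    rw [LinearIsometryEquiv.norm_map, HilbertSchmidt.mul_rankOne, HilbertSchmidt.mul_rankOne,
      HilbertSchmidt.norm_rankOne, HilbertSchmidt.norm_rankOne, e.orthonormal.1, mul_one, mul_one]
  refine (Finset.sum_le_sum h1).trans (le_of_sq_le_sq ?_ (by positivity))
  refine (Finset.sum_mul_sq_le_sq_mul_sq s _ _).trans ?_
  rw [mul_pow]
  exact mul_le_mul (sum_norm_sq_apply_le e s S) (sum_norm_sq_apply_le e s T) (by positivity)
    (by positivity)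

/-- The sequence `eₙ₀* ⊗ eₙ₀` has a cluster point in the right topological centre that is not in the
algebra: the functional `S* ⊗ T ↦ ⟪S, T⟫` is `1` on the sequence, while the matrix coefficients,
which separate the tensors, tend to zero along it. -/
theorem not_isRightStronglyArensIrregular_induced (e : HilbertBasis ℕ ℂ H) {X : Type*}
    [NormedAddCommGroup X] [NormedSpace ℂ X] [CompleteSpace X]
    (Φ : X ≃ₗᵢ[ℂ] ProjTensor (StrongDual ℂ (HilbertSchmidt H)) (HilbertSchmidt H)) :
    ¬ ((dualTensorAlgebra H).induced Φ).IsRightStronglyArensIrregular := by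
  refine BanachAlgebraStructure.not_isRightStronglyArensIrregular_of_seq (C := 1) _
    (a := fun n => Φ.symm (diagTensor (HilbertSchmidt.rankOne (e n) (e 0))))
    (fun n => ?_) (fun s b => ?_)
    ⟨ProjTensor.pairing (.id ℂ (HilbertSchmidt H)) ∘L (Φ : X →L[ℂ] _), fun n => ?_⟩
    fun x hx => ?_
  · rw [LinearIsometryEquiv.norm_map]
    exact norm_diagTensor_rankOne_le e n 0
  · simp only [BanachAlgebraStructure.induced_mul, LinearIsometryEquiv.norm_map,
      LinearIsometryEquiv.apply_symm_apply]
    exact (sum_norm_mul_diagTensor_le e s (Φ b)).trans_eq (Φ.norm_map b)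
  · refine (congrArg (ProjTensor.pairing (.id ℂ _)) (Φ.apply_symm_apply _)).trans ?_
    rw [pairing_diagTensor, ContinuousLinearMap.id_apply, inner_self_eq_norm_sq_to_K,
      HilbertSchmidt.norm_rankOne, e.orthonormal.1, e.orthonormal.1]
    simp
  · have h : ProjTensor.toOperator (Φ x) ≠ 0 := fun h => hx <| by
      rw [← Φ.map_eq_zero_iff]
      exact toOperator_injective (h.trans (map_zero _).symm)
    obtain ⟨S, hS⟩ := DFunLike.ne_iff.1 h
    let c : StrongDual ℂ (HilbertSchmidt H →L[ℂ] HilbertSchmidt H) :=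
      innerSL ℂ (ProjTensor.toOperator (Φ x) S) ∘L ContinuousLinearMap.apply ℂ _ S
    refine ⟨c ∘L ProjTensor.toOperator ∘L (Φ : X →L[ℂ] _), ?_, ?_⟩
    · exact inner_self_ne_zero.2 hS
    · have h0 : ∀ R : HilbertSchmidt H, Tendsto
          (fun n => ⟪HilbertSchmidt.rankOne (e n) (e 0), R⟫_ℂ) atTop (𝓝 0) := fun R => by
        have ho := (HilbertSchmidt.orthonormal_rankOne e).comp (fun n : ℕ => (n, 0))
          fun m n hmn => (Prod.mk.inj hmn).1
        have h2 := (ho.inner_products_summable R).tendsto_atTop_zero.sqrt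
        simp only [Real.sqrt_zero, Real.sqrt_sq (norm_nonneg _)] at h2
        exact tendsto_zero_iff_norm_tendsto_zero.2 h2
      have h3 := (h0 S).mul ((Complex.continuous_conj.tendsto _).comp
        (h0 (ProjTensor.toOperator (Φ x) S)))
      rw [zero_mul] at h3
      refine h3.congr fun n => ?_
      change _ = c (ProjTensor.toOperator (Φ (Φ.symm _)))
      rw [Φ.apply_symm_apply, diagTensor, ProjTensor.toOperator_tmul, Function.comp_apply,
        inner_conj_symm]
      exact (inner_smul_right (ProjTensor.toOperator (Φ x) S) _ _).symm

end Counterexamples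

end Predual

end

theorem mainTheorem6 {H : Type*} [NormedAddCommGroup H] [InnerProductSpace ℂ H] [CompleteSpace H]
    [TopologicalSpace.SeparableSpace H] (hH : ¬ FiniteDimensional ℂ H) :
    -- `S₁(H)` is the predual of `B(H)`, through the trace pairing
    (∃ Θ : (H →L[ℂ] H) ≃ₗᵢ[ℂ] StrongDual ℂ (Predual.TraceClass H),
      ∀ (e : HilbertBasis ℕ ℂ H) (B : H →L[ℂ] H) (T : Predual.TraceClass H),
        HasSum (fun n => ⟪e n, B (Predual.TraceClass.toOp T (e n))⟫_ℂ) (Θ B T)) ∧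
    -- `H ≅ S₂(H)` as Hilbert spaces
    Nonempty (H ≃ₗᵢ[ℂ] Predual.HilbertSchmidt H) ∧
    -- `S₂(H)* ⊗^γ S₂(H) ≅ S₂(H) ⊗^γ S₂(H)` as Banach algebras
    (∃ Ξ : Predual.ProjTensor (StrongDual ℂ (Predual.HilbertSchmidt H))
          (Predual.HilbertSchmidt H) ≃ₗᵢ[ℂ]
        Predual.ProjTensor (Predual.HilbertSchmidt H) (Predual.HilbertSchmidt H),
      ∀ u v, Ξ (((Predual.hilbertSchmidtDualAlgebra H).projTensor
          (Predual.hilbertSchmidtAlgebra H)).mul u v) =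
        ((Predual.hilbertSchmidtAlgebra H).projTensor
          (Predual.hilbertSchmidtAlgebra H)).mul (Ξ u) (Ξ v)) ∧
    -- the natural identification `S₁(H) ≅ H* ⊗^γ H`
    ∃ Φ : Predual.TraceClass H ≃ₗᵢ[ℂ] Predual.ProjTensor (StrongDual ℂ H) H,
      (∀ (φ : StrongDual ℂ H) (y : H),
        Predual.TraceClass.toOp (Φ.symm (Predual.ProjTensor.tmul φ y)) = φ.smulRight y) ∧
      -- `H* ⊗^γ H ≅ S₂(H)* ⊗^γ S₂(H)`, induced by any unitary `H ≅ S₂(H)`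
      ∀ V : H ≃ₗᵢ[ℂ] Predual.HilbertSchmidt H,
        ∃ Ψ : Predual.ProjTensor (StrongDual ℂ H) H ≃ₗᵢ[ℂ]
            Predual.ProjTensor (StrongDual ℂ (Predual.HilbertSchmidt H))
              (Predual.HilbertSchmidt H),
          (∀ (φ : StrongDual ℂ H) (y : H), Ψ (Predual.ProjTensor.tmul φ y) =
            Predual.ProjTensor.tmul
              (φ ∘L (V.symm.toContinuousLinearEquiv : Predual.HilbertSchmidt H →L[ℂ] H)) (V y)) ∧
          -- the multiplication that `S₁(H)` inherits from `S₂(H)* ⊗^γ S₂(H)`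
          ¬ (((Predual.hilbertSchmidtDualAlgebra H).projTensor
              (Predual.hilbertSchmidtAlgebra H)).induced (Φ.trans Ψ)).IsArensRegular ∧
          ¬ (((Predual.hilbertSchmidtDualAlgebra H).projTensor
              (Predual.hilbertSchmidtAlgebra H)).induced
                (Φ.trans Ψ)).IsStronglyArensIrregular := by
  obtain ⟨e⟩ := Predual.nonempty_hilbertBasis_nat hH
  refine ⟨⟨Predual.tracePairing H, Predual.hasSum_tracePairing⟩,
    Predual.HilbertSchmidt.nonempty_linearIsometryEquiv e,
    ⟨Predual.ProjTensor.congr (Predual.HilbertSchmidt.dualEquiv e) (.refl ℂ _),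
      Predual.ProjTensor.congr_mul (Predual.HilbertSchmidt.dualEquiv_mul e) fun _ _ => rfl⟩,
    (Predual.tensorEquivTraceClass H).symm, fun φ y => ?_, fun V =>
      ⟨Predual.ProjTensor.congr (Predual.dualCongr V) V, fun φ y => ?_,
        Predual.not_isArensRegular_induced e _, fun h =>
          Predual.not_isRightStronglyArensIrregular_induced e _ h.2⟩⟩
  · rw [LinearIsometryEquiv.symm_symm, Predual.tensorEquivTraceClass_tmul]
    rfl
  · exact Predual.ProjTensor.congr_tmul _ _ φ y
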